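/- **Problem (IFDP).** Let $(\mathcal N,\mathcal A)$ be a finite directed graph with arc capacities $c_a\ge 0$, let $u_1,\dots,u_k>0$ be the available capacity units, and let $\mathcal F=\{1,\dots,F\}$, $F\ge 1$, be a set of flows, where flow $f$ has an origin $o_f$, a destination $d_f\ne o_f$, a size $s_f>0$ and a deadline $t_f\in\mathbb R\cup\{\infty\}$; the flows are numbered so that $t_1\le\dots\le t_F$. A *rate vector* is a vector $r\in\mathbb R_{\ge0}^F$ for which there are arc rates $y_{fa}\ge0$ and integers $z^m_{fa}\ge0$ such that for every $f$ the net outflow of $(y_{fa})_a$ is $r_f$ at $o_f$, $-r_f$ at $d_f$ and $0$ at every other node, $y_{fa}\le\sum_m u_mz^m_{fa}$ for all $f,a$, and $\sum_f\sum_m u_mz_{fa}^m\le c_a$ for all $a$. Let $\mathcal V$ be the set of all rate vectors. A *schedule* is a finite sequence of consecutive time periods starting at time $0$, each with a duration $>0$ and a rate vector in $\mathcal V$. It is *feasible* if for every flow $f$ the total amount of data delivered (the sum of rate times duration) is $s_f$ and the completion time of $f$ (the end of the last period in which the rate of $f$ is positive) is at most $t_f$. It is *optimal* if it is feasible and its overall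 completion time (the largest completion time of a flow) is minimal among all feasible schedules. **Algorithm (CGA).** For a finite $V\subseteq\mathcal V$, the restricted master problem RMP$(V)$ is $$\min\sum_{v\in V}x_v\quad\text{s.t.}\quad \sum_{v\in V:\,v_f>0}v_fx_v=s_f,\qquad \sum_{v\in V:\,v_g>0\text{ for some }g\le f}x_v\le t_f\quad(f\in\mathcal F),\qquad x_v\ge0 .$$ For dual values $\lambda_f$ (size constraints) and $\pi_f\le0$ (deadline constraints, $\pi_f=0$ if $t_f=\infty$) and $v\in\mathcal V$, let $f^{++}(v)$ be the first flow with positive rate in $v$ ($F+1$ if there is none), and let $\mathrm{rc}(v)=1-\sum_{f\ge f^{++}(v)}v_f\lambda_f-\sum_{f\ge f^{++}(v)}\pi_f$. The subproblem SP$_{f^+}$ is to minimize $1-\sum_{f\ge f^+}r_f\lambda_f$ over all $r\in\mathcal V$ with $r_f=0$ for $f<f^+$. CGA starts with a finite set $V_0\subseteq\mathcal V$ for which RMP$(V_0)$ is feasible, puts $V=V_0$, and repeats the following. 1. Find an optimal solution $x$ of RMP$(V)$ and an optimal solution $(\lambda,\pi)$ of its dual. 2. Put $f^+=1$ and best value $\infty$.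 While $f^+\le F$: find an optimal rate vector $r$ of SP$_{f^+}$; if $\mathrm{rc}(r)$ is smaller than the best value, make $\mathrm{rc}(r)$ the best value and put $v^*=r$; in either case put $f^+=f^{++}(r)+1$. 3. If $\mathrm{rc}(v^*)<0$, add $v^*$ to $V$. If $\mathrm{rc}(v^*)=0$, stop; otherwise go to 1. After stopping, a schedule is constructed from $x$: for $f=1,\dots,F$ in turn, use the vectors $v\in V$ with $x_v>0$ and $f^{++}(v)=f$, in any order, each for the duration $x_v$. All optimal solutions in the algorithm are arbitrary. **Theorem 4.** For every instance, a set $V_0$ with which CGA can start exists if and only if IFDP has a feasible schedule. Moreover, there is a number $N$, depending only on the instance, such that for every such $V_0$: every run of CGA makes at most $N$ steps (each solution of an RMP together with its dual, each solution of a subproblem and each execution of item 3 counting as a step); the algorithm can always continue until it stops (every optimization problem that it meets has an optimal solution); and when it stops, every schedule constructed from $x$ is an optimal schedule of IFDP. -/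

import Mathlib

/-- An instance of the integer flow with deadline problem on the node set `Node`.
The flows are `0, …, F - 1`, indexed by ascending deadline; the deadline `⊤` means that the
flow has no deadline. -/
structure IFDP (Node : Type*) [Fintype Node] [DecidableEq Node] where
  /-- the arcs of the directed network -/
  arcs : Finset (Node × Node)
  /-- arc capacities -/
  cap : arcs → ℝ
  /-- number of available capacity units -/
  k : ℕ
  /-- sizes of the capacity units -/
  unit : Fin k → ℝ
  /-- number of flows -/
  F : ℕ
  origin : Fin F → Node
  dest : Fin F → Node
  deadline : Fin F → WithTop ℝ
  size : Fin F → ℝ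
  cap_nonneg : ∀ a, 0 ≤ cap a
  unit_pos : ∀ m, 0 < unit m
  F_pos : 0 < F
  origin_ne_dest : ∀ f, origin f ≠ dest f
  deadline_mono : Monotone deadline
  size_pos : ∀ f, 0 < size f

/-- End-to-end rate vectors of `F` flows. -/
abbrev RateVector (F : ℕ) : Type := Fin F → ℝ

/-- The smallest index of a flow with positive rate in `v`
(and `F` if there is no such flow). -/
noncomputable def firstFlow {F : ℕ} (v : RateVector F) : ℕ :=
  sInf {n : ℕ | ∀ h : n < F, 0 < v ⟨n, h⟩}

/-- Values of the dual variables of a (restricted) master problem: `lam f` belongs to the size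
constraint and `pi f` to the deadline constraint of flow `f`. -/
structure DualValues (F : ℕ) where
  lam : Fin F → ℝ
  pi : Fin F → ℝ

/-- The reduced cost of the rate vector `v`. -/
noncomputable def reducedCost {F : ℕ} (μ : DualValues F) (v : RateVector F) : ℝ :=
  1 - (∑ f ∈ Finset.univ.filter (fun f : Fin F => firstFlow v ≤ f.val), v f * μ.lam f)
    - ∑ f ∈ Finset.univ.filter (fun f : Fin F => firstFlow v ≤ f.val), μ.pi f

/-- A time period of a schedule: a positive length of time and the rate vector in use. -/
structure Period (F : ℕ) where
  dur : ℝ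
  rate : RateVector F

/-- A schedule: consecutive time periods, the first of which starts at time `0`. -/
abbrev Schedule (F : ℕ) : Type := List (Period F)

namespace Schedule

variable {F : ℕ}

/-- The time at which the period in position `p` ends. -/
noncomputable def endTime (σ : Schedule F) (p : Fin σ.length) : ℝ :=
  ((σ.take ((p : ℕ) + 1)).map Period.dur).sum

/-- The amount of data of flow `f` that is delivered. -/
noncomputable def delivered (σ : Schedule F) (f : Fin F) : ℝ :=
  (σ.map fun p => p.dur * p.rate f).sum

/-- The completion time of flow `f`: the end of the last period in which its rate is positive
(`0` if there is none). -/
noncomputable def completionTime (σ : Schedule F) (f : Fin F) : ℝ :=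
  ⨆ p : {p : Fin σ.length // 0 < (σ.get p).rate f}, endTime σ p.1

/-- The overall completion time. -/
noncomputable def makespan (σ : Schedule F) : ℝ :=
  ⨆ f : Fin F, completionTime σ f

end Schedule

namespace IFDP

variable {Node : Type*} [Fintype Node] [DecidableEq Node] (I : IFDP Node)

/-- The rate vector `r` is realized by the arc rates `y`, where `z f a m` is the number of times
that capacity unit `m` is allocated to flow `f` on arc `a`. -/
structure Realizes (r : RateVector I.F) (y : Fin I.F → I.arcs → ℝ)
    (z : Fin I.F → I.arcs → Fin I.k → ℕ) : Prop where
  balance : ∀ f i,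
    (∑ a : I.arcs with a.1.1 = i, y f a) - (∑ a : I.arcs with a.1.2 = i, y f a)
      = if i = I.origin f then r f else if i = I.dest f then -r f else 0
  arc_rate_le : ∀ f a, y f a ≤ ∑ m, I.unit m * (z f a m : ℝ)
  alloc_le : ∀ a, ∑ f, ∑ m, I.unit m * (z f a m : ℝ) ≤ I.cap a
  rate_nonneg : ∀ f, 0 ≤ r f
  arc_rate_nonneg : ∀ f a, 0 ≤ y f a

/-- The set `𝒱` of all end-to-end rate vectors. -/
def rateVectors : Set (RateVector I.F) :=
  {r | ∃ y z, I.Realizes r y z}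

/-- A feasible solution of the problem. -/
structure IsFeasible (σ : Schedule I.F) : Prop where
  dur_pos : ∀ p ∈ σ, 0 < p.dur
  rate_mem : ∀ p ∈ σ, p.rate ∈ I.rateVectors
  delivered_eq : ∀ f, Schedule.delivered σ f = I.size f
  deadline : ∀ f, ((Schedule.completionTime σ f : ℝ) : WithTop ℝ) ≤ I.deadline f

/-- A globally optimal solution of the problem. -/
def IsOptimal (σ : Schedule I.F) : Prop :=
  I.IsFeasible σ ∧ ∀ σ', I.IsFeasible σ' → Schedule.makespan σ ≤ Schedule.makespan σ'

/-- `x` is feasible in the master problem restricted to the rate vectors in `V`. -/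
structure RMPFeasible (V : Finset (RateVector I.F)) (x : RateVector I.F → ℝ) : Prop where
  size_eq : ∀ f, ∑ v ∈ V with 0 < v f, v f * x v = I.size f
  deadline : ∀ f, ((∑ v ∈ V with ∃ g ≤ f, 0 < v g, x v : ℝ) : WithTop ℝ) ≤ I.deadline f
  nonneg : ∀ v ∈ V, 0 ≤ x v

/-- `x` is an optimal solution of the restricted master problem. -/
def RMPOptimal (V : Finset (RateVector I.F)) (x : RateVector I.F → ℝ) : Prop :=
  I.RMPFeasible V x ∧ ∀ x', I.RMPFeasible V x' → ∑ v ∈ V, x v ≤ ∑ v ∈ V, x' v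

/-- Feasibility in the dual linear program of the restricted master problem. A flow without
deadline has no deadline constraint, which amounts to a dual value `0`. -/
structure DualFeasible (V : Finset (RateVector I.F)) (μ : DualValues I.F) : Prop where
  column : ∀ v ∈ V,
    (∑ f with 0 < v f, v f * μ.lam f) + (∑ f with ∃ g ≤ f, 0 < v g, μ.pi f) ≤ 1
  pi_nonpos : ∀ f, μ.pi f ≤ 0
  pi_eq_zero : ∀ f, I.deadline f = ⊤ → μ.pi f = 0

/-- The objective function of the dual of the restricted master problem (a flow without
deadline contributes nothing to the second sum). -/
noncomputable def dualValue (μ : DualValues I.F) : ℝ :=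
  (∑ f, I.size f * μ.lam f) + ∑ f, (I.deadline f).untopD 0 * μ.pi f

/-- `μ` consists of optimal dual values of the restricted master problem. -/
def DualOptimal (V : Finset (RateVector I.F)) (μ : DualValues I.F) : Prop :=
  I.DualFeasible V μ ∧ ∀ μ', I.DualFeasible V μ' → I.dualValue μ' ≤ I.dualValue μ

/-- The objective function of the subproblem with index `fp`. -/
noncomputable def spObjective (μ : DualValues I.F) (fp : ℕ) (r : RateVector I.F) : ℝ :=
  1 - ∑ f ∈ Finset.univ.filter (fun f : Fin I.F => fp ≤ f.val), r f * μ.lam f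

/-- Feasibility in the subproblem with index `fp`: only the flows `fp, fp + 1, …` may have a
positive rate. -/
def SPFeasible (fp : ℕ) (r : RateVector I.F) (y : Fin I.F → I.arcs → ℝ)
    (z : Fin I.F → I.arcs → Fin I.k → ℕ) : Prop :=
  I.Realizes r y z ∧ ∀ f : Fin I.F, (f : ℕ) < fp → r f = 0

/-- `r` is an optimal rate vector of the subproblem with index `fp`. -/
def SPOptimal (μ : DualValues I.F) (fp : ℕ) (r : RateVector I.F) : Prop :=
  (∃ y z, I.SPFeasible fp r y z) ∧
    ∀ r' y' z', I.SPFeasible fp r' y' z' → I.spObjective μ fp r ≤ I.spObjective μ fp r'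

/-- The states of the column generation algorithm. -/
inductive State (F : ℕ) : Type
  /-- the restricted master problem over `V` is to be solved -/
  | master (V : Finset (RateVector F))
  /-- head of the loop that solves the subproblems: `x` and `μ` are the primal and dual solutions
  of the restricted master problem, `fp` is the index of the next subproblem, `optimum` is the
  best reduced cost found so far and `best` the rate vector that attains it -/
  | pricing (V : Finset (RateVector F)) (x : RateVector F → ℝ) (μ : DualValues F)
      (fp : ℕ) (optimum : WithTop ℝ) (best : Option (RateVector F))
  /-- the algorithm has stopped, and `x` solves the last restricted master problem -/
  | done (V : Finset (RateVector F)) (x : RateVector F → ℝ)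

/-- The steps of the column generation algorithm. Wherever it solves an optimization problem,
any optimal solution may be returned. -/
inductive Step : State I.F → State I.F → Prop
  | solveRMP (V : Finset (RateVector I.F)) (x : RateVector I.F → ℝ) (μ : DualValues I.F) :
      I.RMPOptimal V x → I.DualOptimal V μ →
      Step (.master V) (.pricing V x μ 0 ⊤ none)
  | solveSPImprove (V : Finset (RateVector I.F)) (x : RateVector I.F → ℝ) (μ : DualValues I.F)
      (fp : ℕ) (optimum : WithTop ℝ) (best : Option (RateVector I.F)) (r : RateVector I.F) :
      fp < I.F → I.SPOptimal μ fp r → ((reducedCost μ r : ℝ) : WithTop ℝ) < optimum →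
      Step (.pricing V x μ fp optimum best)
        (.pricing V x μ (firstFlow r + 1) ((reducedCost μ r : ℝ) : WithTop ℝ) (some r))
  | solveSPSkip (V : Finset (RateVector I.F)) (x : RateVector I.F → ℝ) (μ : DualValues I.F)
      (fp : ℕ) (optimum : WithTop ℝ) (best : Option (RateVector I.F)) (r : RateVector I.F) :
      fp < I.F → I.SPOptimal μ fp r → ¬ ((reducedCost μ r : ℝ) : WithTop ℝ) < optimum →
      Step (.pricing V x μ fp optimum best)
        (.pricing V x μ (firstFlow r + 1) optimum best)
  | addColumn (V : Finset (RateVector I.F)) (x : RateVector I.F → ℝ) (μ : DualValues I.F)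
      (fp : ℕ) (optimum : WithTop ℝ) (v : RateVector I.F) :
      I.F ≤ fp → reducedCost μ v < 0 →
      Step (.pricing V x μ fp optimum (some v)) (.master (insert v V))
  | noColumn (V : Finset (RateVector I.F)) (x : RateVector I.F → ℝ) (μ : DualValues I.F)
      (fp : ℕ) (optimum : WithTop ℝ) (v : RateVector I.F) :
      I.F ≤ fp → 0 < reducedCost μ v →
      Step (.pricing V x μ fp optimum (some v)) (.master V)
  | halt (V : Finset (RateVector I.F)) (x : RateVector I.F → ℝ) (μ : DualValues I.F)
      (fp : ℕ) (optimum : WithTop ℝ) (v : RateVector I.F) :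
      I.F ≤ fp → reducedCost μ v = 0 →
      Step (.pricing V x μ fp optimum (some v)) (.done V x)

/-- Admissible initial sets: finitely many rate vectors for which the restricted master problem
has a feasible solution. -/
def IsInitial (V : Finset (RateVector I.F)) : Prop :=
  (∀ v ∈ V, v ∈ I.rateVectors) ∧ ∃ x, I.RMPFeasible V x

/-- The rate vectors used by `x` in which `f` is the first flow of positive rate. -/
noncomputable def firstClass (V : Finset (RateVector I.F)) (x : RateVector I.F → ℝ)
    (f : Fin I.F) : Finset (RateVector I.F) :=
  {v ∈ V | 0 < x v ∧ firstFlow v = (f : ℕ)}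

/-- `σ` is a schedule constructed from `x`: for `f = 0, …, F - 1` in turn, it uses the rate
vectors of `firstClass V x f`, in any order `q f`, with the durations given by `x`. -/
def IsConstructedSchedule (V : Finset (RateVector I.F)) (x : RateVector I.F → ℝ)
    (σ : Schedule I.F) : Prop :=
  ∃ q : Fin I.F → List (RateVector I.F),
    (∀ f, (q f).Nodup ∧ (q f).toFinset = I.firstClass V x f) ∧
    σ = (List.finRange I.F).flatMap fun f => (q f).map fun v => ⟨x v, v⟩

end IFDP

/-! Optimality is a duality sandwich. If the columns of a master solution are used in ascending
order of their first flow, then flow `f` finishes by the total time of the columns whose first flow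
is at most `f`. So the deadline constraints suffice, and the makespan is at most the master value.
Conversely, the usage times of the rate vectors of any feasible schedule solve the master problem
over those vectors: the time spent serving flows `g ≤ f` is at most the completion time of one such
`g`, and deadlines ascend. Hence dual values that satisfy the column constraint for every rate
vector bound every makespan from below. Strong duality, obtained from Farkas' lemma, closes the gap.

The pricing loop finds the least reduced cost over all nonzero rate vectors. The subproblem at `fp`
with solution `r` settles all vectors whose first flow lies between `fp` and that of `r`: such a
vector has no better objective, and its sum of the nonpositive `pi` ranges over at least as many
flows. This justifies jumping to `firstFlow r + 1`.

Termination needs more than a count of columns, because there may be infinitely many rate vectors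
and a subproblem may return non-vertices. Each vector gets one of finitely many combinatorial types:
an integer allocation together with the set of tight inequalities. If a subproblem optimum `r` had
the type of some `v ∈ V`, then `r` could be moved slightly away from `v` and stay feasible.
Optimality of `r` then makes the reduced cost of `v` at most that of `r`, which is impossible if the
latter is negative, since dual feasibility makes the former nonnegative. So every added column has a
new type (`PricingInvariant.someProfile_notMem`).

A strictly positive best reduced cost would make the algorithm cycle; complementary slackness
excludes it, since some column of `V` has reduced cost `0`. -/

/-! ### Linear inequalities -/

/-- **Farkas' lemma** for finitely many linear functionals on a real vector space. -/
theorem exists_nonneg_combination {E ι : Type*} [AddCommGroup E] [Module ℝ E] (s : Finset ι) :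
    ∀ (a : ι → E →ₗ[ℝ] ℝ) (c : E →ₗ[ℝ] ℝ),
      (∀ x, (∀ i ∈ s, 0 ≤ a i x) → 0 ≤ c x) →
      ∃ w : ι → ℝ, (∀ i, 0 ≤ w i) ∧ ∀ x, c x = ∑ i ∈ s, w i * a i x := by
  classical
  induction s using Finset.induction_on with
  | empty =>
    intro a c h
    refine ⟨0, fun _ => le_rfl, fun x => ?_⟩
    have h1 := h x (by simp)
    have h2 := h (-x) (by simp)
    rw [map_neg] at h2
    simp only [Finset.sum_empty]
    linarith
  | insert j s hj ih =>
    intro a c h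
    by_cases hc : ∀ x, (∀ i ∈ s, 0 ≤ a i x) → 0 ≤ c x
    · obtain ⟨w, hw, hcw⟩ := ih a c hc
      refine ⟨Function.update w j 0, fun i => ?_, fun x => ?_⟩
      · by_cases hi : i = j
        · subst hi; simp
        · simpa [hi] using hw i
      · rw [Finset.sum_insert hj, hcw x]
        simp only [Function.update_self, zero_mul, zero_add]
        refine Finset.sum_congr rfl fun i hi => ?_
        rw [Function.update_of_ne (ne_of_mem_of_not_mem hi hj)]
    · push Not at hc
      obtain ⟨x₀, hx₀, hcx₀⟩ := hc
      have hb : a j x₀ < 0 := by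
        by_contra hb
        refine absurd (h x₀ fun i hi => ?_) (not_le.mpr hcx₀)
        rcases Finset.mem_insert.mp hi with rfl | hi
        · exact not_lt.mp hb
        · exact hx₀ i hi
      have hb' : a j x₀ ≠ 0 := hb.ne
      -- Project along `x₀` onto the kernel of `a j`: the new functionals are the old ones evaluated
      -- at `x - (a j x / a j x₀) • x₀`.
      obtain ⟨w, hw, hcw⟩ := ih (fun i => a i - (a i x₀ / a j x₀) • a j)
        (c - (c x₀ / a j x₀) • a j) (by
          intro x hx
          have := h (x - (a j x / a j x₀) • x₀) (by
            intro i hi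
            rw [map_sub, map_smul, smul_eq_mul]
            rcases Finset.mem_insert.mp hi with rfl | hi
            · rw [div_mul_cancel₀ _ hb', sub_self]
            · have := hx i hi
              simp only [LinearMap.sub_apply, LinearMap.smul_apply, smul_eq_mul] at this
              convert this using 2
              ring)
          rw [map_sub, map_smul, smul_eq_mul] at this
          simp only [LinearMap.sub_apply, LinearMap.smul_apply, smul_eq_mul]
          convert this using 2
          ring)
      have hS : 0 ≤ ∑ i ∈ s, w i * a i x₀ :=
        Finset.sum_nonneg fun i hi => mul_nonneg (hw i) (hx₀ i hi)
      -- The weight of `j` is forced by evaluating the combination at `x₀`; it is nonnegative as a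
      -- quotient of two negative numbers.
      refine ⟨Function.update w j ((c x₀ - ∑ i ∈ s, w i * a i x₀) / a j x₀), fun i => ?_,
        fun x => ?_⟩
      · by_cases hi : i = j
        · subst hi
          rw [Function.update_self]
          exact div_nonneg_of_nonpos (by linarith) hb.le
        · simpa [hi] using hw i
      · have h1 := hcw x
        simp only [LinearMap.sub_apply, LinearMap.smul_apply, smul_eq_mul, mul_sub,
          Finset.sum_sub_distrib] at h1
        have h2 : ∑ i ∈ s, w i * (a i x₀ / a j x₀ * a j x)
            = (∑ i ∈ s, w i * a i x₀) / a j x₀ * a j x := by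
          rw [Finset.sum_div, Finset.sum_mul]
          exact Finset.sum_congr rfl fun i _ => by ring
        have h3 : ∑ i ∈ s, Function.update w j ((c x₀ - ∑ i ∈ s, w i * a i x₀) / a j x₀) i * a i x
            = ∑ i ∈ s, w i * a i x :=
          Finset.sum_congr rfl fun i hi => by
            rw [Function.update_of_ne (ne_of_mem_of_not_mem hi hj)]
        rw [Finset.sum_insert hj, Function.update_self, h3, sub_div, sub_mul]
        linarith

/-! ### First flow of a rate vector -/

section FirstFlow

variable {F : ℕ} {v w : RateVector F}

theorem pos_firstFlow (h : firstFlow v < F) : 0 < v ⟨firstFlow v, h⟩ := by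
  have hne : {n : ℕ | ∀ h : n < F, 0 < v ⟨n, h⟩}.Nonempty := ⟨F, fun h => absurd h (lt_irrefl F)⟩
  exact Nat.sInf_mem hne h

theorem firstFlow_le_of_pos {f : Fin F} (h : 0 < v f) : firstFlow v ≤ f :=
  Nat.sInf_le fun _ => h

theorem not_pos_of_lt_firstFlow {f : Fin F} (h : (f : ℕ) < firstFlow v) : ¬ 0 < v f :=
  fun hf => absurd (firstFlow_le_of_pos hf) (not_le.mpr h)

theorem le_firstFlow {n : ℕ} (hn : n ≤ F) (h : ∀ f : Fin F, (f : ℕ) < n → ¬ 0 < v f) :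
    n ≤ firstFlow v := by
  by_contra hlt
  have hF : firstFlow v < F := by omega
  exact h ⟨firstFlow v, hF⟩ (by simpa using hlt) (pos_firstFlow hF)

theorem exists_pos_iff_firstFlow_le {f : Fin F} :
    (∃ g ≤ f, 0 < v g) ↔ firstFlow v ≤ (f : ℕ) := by
  constructor
  · rintro ⟨g, hg, hv⟩
    exact (firstFlow_le_of_pos hv).trans hg
  · intro h
    exact ⟨⟨firstFlow v, h.trans_lt f.2⟩, h, pos_firstFlow _⟩

theorem exists_pos_iff_firstFlow_lt : (∃ g, 0 < v g) ↔ firstFlow v < F :=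
  ⟨fun ⟨g, hg⟩ => (firstFlow_le_of_pos hg).trans_lt g.2, fun h => ⟨_, pos_firstFlow h⟩⟩

theorem firstFlow_congr (h : ∀ f, 0 < v f ↔ 0 < w f) : firstFlow v = firstFlow w := by
  simp only [firstFlow, h]

theorem eq_zero_of_lt_firstFlow (hv : ∀ f, 0 ≤ v f) {f : Fin F} (h : (f : ℕ) < firstFlow v) :
    v f = 0 :=
  le_antisymm (not_lt.mp (not_pos_of_lt_firstFlow h)) (hv f)

end FirstFlow

/-! ### Reduced costs and weak duality -/

/-- The left-hand side of the dual constraint that belongs to the rate vector `v`. -/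
noncomputable def columnValue {F : ℕ} (μ : DualValues F) (v : RateVector F) : ℝ :=
  (∑ f with 0 < v f, v f * μ.lam f) + (∑ f with ∃ g ≤ f, 0 < v g, μ.pi f)

/-- Flows of rate zero contribute nothing, so any threshold below the support gives the same sum.
This lets the subproblem objective (threshold `fp`), the reduced cost (threshold `firstFlow v`) and
the dual constraint be compared. -/
theorem sum_filter_le_eq_sum_pos {F : ℕ} {v : RateVector F} (hv : ∀ f, 0 ≤ v f) (l : Fin F → ℝ)
    {n : ℕ} (hn : ∀ f : Fin F, 0 < v f → n ≤ f) :
    ∑ f ∈ Finset.univ.filter (fun f : Fin F => n ≤ f.val), v f * l f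
      = ∑ f with 0 < v f, v f * l f := by
  rw [Finset.sum_filter, Finset.sum_filter]
  refine Finset.sum_congr rfl fun f _ => ?_
  by_cases h : 0 < v f
  · rw [if_pos h, if_pos (hn f h)]
  · rw [le_antisymm (not_lt.mp h) (hv f)]
    simp

theorem reducedCost_eq {F : ℕ} (μ : DualValues F) {v : RateVector F} (hv : ∀ f, 0 ≤ v f) :
    reducedCost μ v = 1 - columnValue μ v := by
  have h : ∑ f ∈ Finset.univ.filter (fun f : Fin F => firstFlow v ≤ f.val), μ.pi f
      = ∑ f with ∃ g ≤ f, 0 < v g, μ.pi f := by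
    rw [Finset.sum_filter, Finset.sum_filter]
    simp only [exists_pos_iff_firstFlow_le]
  rw [reducedCost, columnValue, h, sum_filter_le_eq_sum_pos hv _ fun _ => firstFlow_le_of_pos]
  ring

/-- Pricing does not control the zero vector; its dual constraint holds anyway, as `0 ≤ 1`. -/
theorem columnValue_eq_zero {F : ℕ} (μ : DualValues F) {v : RateVector F}
    (hv : ¬ ∃ f, 0 < v f) : columnValue μ v = 0 := by
  push Not at hv
  rw [columnValue, Finset.sum_eq_zero, Finset.sum_eq_zero, add_zero]
  · intro f hf
    obtain ⟨g, -, hg⟩ := (Finset.mem_filter.mp hf).2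
    exact absurd hg (not_lt.mpr (hv g))
  · intro f hf
    exact absurd (Finset.mem_filter.mp hf).2 (not_lt.mpr (hv f))

theorem sum_mul_columnValue {F : ℕ} (V : Finset (RateVector F)) (x : RateVector F → ℝ)
    (μ : DualValues F) :
    ∑ v ∈ V, x v * columnValue μ v
      = (∑ f, (∑ v ∈ V with 0 < v f, v f * x v) * μ.lam f)
        + ∑ f, (∑ v ∈ V with ∃ g ≤ f, 0 < v g, x v) * μ.pi f := by
  simp only [columnValue, mul_add, Finset.sum_add_distrib, Finset.sum_filter, Finset.mul_sum,
    Finset.sum_mul]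
  congr 1
  · rw [Finset.sum_comm]
    refine Finset.sum_congr rfl fun f _ => Finset.sum_congr rfl fun v _ => ?_
    split_ifs <;> ring
  · rw [Finset.sum_comm]
    refine Finset.sum_congr rfl fun f _ => Finset.sum_congr rfl fun v _ => ?_
    split_ifs <;> ring

namespace IFDP

variable {Node : Type*} [Fintype Node] [DecidableEq Node] {I : IFDP Node}

theorem DualFeasible.columnValue_le {V : Finset (RateVector I.F)} {μ : DualValues I.F}
    (h : I.DualFeasible V μ) {v : RateVector I.F} (hv : v ∈ V) : columnValue μ v ≤ 1 :=
  h.column v hv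

/-- Weak duality, before the dual constraints are used. -/
theorem RMPFeasible.dualValue_le {V : Finset (RateVector I.F)} {x : RateVector I.F → ℝ}
    (hx : I.RMPFeasible V x) {μ : DualValues I.F} (hpi : ∀ f, μ.pi f ≤ 0)
    (htop : ∀ f, I.deadline f = ⊤ → μ.pi f = 0) :
    I.dualValue μ ≤ ∑ v ∈ V, x v * columnValue μ v := by
  rw [sum_mul_columnValue, dualValue]
  refine add_le_add (le_of_eq ?_) (Finset.sum_le_sum fun f _ => ?_)
  · exact Finset.sum_congr rfl fun f _ => by rw [hx.size_eq]
  · by_cases hf : I.deadline f = ⊤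
    · rw [htop f hf]; simp
    · obtain ⟨t, ht⟩ := WithTop.ne_top_iff_exists.mp hf
      have h := hx.deadline f
      rw [← ht] at h ⊢
      exact mul_le_mul_of_nonpos_right (WithTop.coe_le_coe.mp h) (hpi f)

theorem RMPFeasible.dualValue_le_sum {V : Finset (RateVector I.F)} {x : RateVector I.F → ℝ}
    (hx : I.RMPFeasible V x) {μ : DualValues I.F} (hμ : I.DualFeasible V μ) :
    I.dualValue μ ≤ ∑ v ∈ V, x v :=
  (hx.dualValue_le hμ.pi_nonpos hμ.pi_eq_zero).trans <| Finset.sum_le_sum fun v hv =>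
    mul_le_of_le_one_right (hx.nonneg v hv) (hμ.columnValue_le hv)

end IFDP

/-! ### Optimal solutions and strong duality for the restricted master problem -/

namespace IFDP

open Filter Topology

variable {Node : Type*} [Fintype Node] [DecidableEq Node] {I : IFDP Node}

theorem RMPFeasible.mono {V W : Finset (RateVector I.F)} (hVW : V ⊆ W)
    {x : RateVector I.F → ℝ} (hx : I.RMPFeasible V x) : ∃ x', I.RMPFeasible W x' := by
  classical
  have key : ∀ (P : RateVector I.F → Prop) [DecidablePred P] (g : RateVector I.F → ℝ),
      ∑ v ∈ W with P v, g v * (if v ∈ V then x v else 0) = ∑ v ∈ V with P v, g v * x v := by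
    intro P _ g
    rw [Finset.sum_filter, Finset.sum_filter, ← Finset.sum_subset hVW]
    · exact Finset.sum_congr rfl fun v hv => by rw [if_pos hv]
    · intro v _ hv
      rw [if_neg hv, mul_zero, ite_self]
  refine ⟨fun v => if v ∈ V then x v else 0, ⟨fun f => ?_, fun f => ?_, fun v _ => ?_⟩⟩
  · rw [key, hx.size_eq]
  · have := key (fun v => ∃ g ≤ f, 0 < v g) (fun _ => 1)
    simp only [one_mul] at this
    rw [this]
    exact hx.deadline f
  · show 0 ≤ (if v ∈ V then x v else 0)
    split_ifs with h
    · exact hx.nonneg v h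
    · exact le_rfl

theorem isClosed_setOf_rmpFeasible (V : Finset (RateVector I.F)) :
    IsClosed {x | I.RMPFeasible V x} := by
  have h1 : IsClosed {x : RateVector I.F → ℝ | ∀ f, ∑ v ∈ V with 0 < v f, v f * x v = I.size f} := by
    simp only [Set.ofPred_forall]
    exact isClosed_iInter fun f => isClosed_eq (by fun_prop) continuous_const
  have h2 : IsClosed {x : RateVector I.F → ℝ |
      ∀ f, ((∑ v ∈ V with ∃ g ≤ f, 0 < v g, x v : ℝ) : WithTop ℝ) ≤ I.deadline f} := by
    simp only [Set.ofPred_forall]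
    refine isClosed_iInter fun f => ?_
    by_cases hf : I.deadline f = ⊤
    · simp [hf]
    · obtain ⟨t, ht⟩ := WithTop.ne_top_iff_exists.mp hf
      simp only [← ht, WithTop.coe_le_coe]
      exact isClosed_le (by fun_prop) continuous_const
  have h3 : IsClosed {x : RateVector I.F → ℝ | ∀ v ∈ V, 0 ≤ x v} := by
    simp only [Set.ofPred_forall]
    exact isClosed_iInter fun v => isClosed_iInter fun _ =>
      isClosed_le continuous_const (by fun_prop)
  convert h1.inter (h2.inter h3) using 1
  ext x
  exact ⟨fun h => ⟨h.1, h.2, h.3⟩, fun h => ⟨h.1, h.2.1, h.2.2⟩⟩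

theorem exists_rmpOptimal {V : Finset (RateVector I.F)} (h : ∃ x, I.RMPFeasible V x) :
    ∃ x, I.RMPOptimal V x := by
  classical
  obtain ⟨x₀, hx₀⟩ := h
  set C := ∑ v ∈ V, x₀ v with hC
  have hC0 : 0 ≤ C := Finset.sum_nonneg hx₀.nonneg
  -- Values off `V` are irrelevant, so they are pinned to `0`; the box is then compact by Tychonoff
  -- even though the index set is infinite.
  let K : Set (RateVector I.F → ℝ) :=
    Set.pi Set.univ fun v => Set.Icc 0 (if v ∈ V then C else 0)
  have hK : IsCompact K := isCompact_univ_pi fun v => isCompact_Icc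
  -- every feasible solution of value at most `C` agrees on `V` with one in `K`
  have trunc : ∀ x, I.RMPFeasible V x → ∑ v ∈ V, x v ≤ C →
      ∃ x' ∈ K ∩ {x | I.RMPFeasible V x}, ∑ v ∈ V, x' v = ∑ v ∈ V, x v := by
    intro x hx hxC
    have heq : ∀ v ∈ V, (if v ∈ V then x v else 0) = x v := fun v hv => if_pos hv
    refine ⟨fun v => if v ∈ V then x v else 0, ⟨fun v _ => ?_, ⟨fun f => ?_, fun f => ?_,
      fun v hv => ?_⟩⟩, Finset.sum_congr rfl heq⟩
    · by_cases hv : v ∈ V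
      · simp only [if_pos hv]
        exact ⟨hx.nonneg v hv, (Finset.single_le_sum hx.nonneg hv).trans hxC⟩
      · simp [hv]
    · rw [← hx.size_eq f]
      exact Finset.sum_congr rfl fun v hv => by rw [heq v (Finset.mem_filter.mp hv).1]
    · convert hx.deadline f using 2
      exact Finset.sum_congr rfl fun v hv => heq v (Finset.mem_filter.mp hv).1
    · rw [heq v hv]; exact hx.nonneg v hv
  obtain ⟨x₁, hx₁, -⟩ := trunc x₀ hx₀ le_rfl
  obtain ⟨x, hx, hmin⟩ := (hK.inter_right (isClosed_setOf_rmpFeasible V)).exists_isMinOn ⟨x₁, hx₁⟩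
    (f := fun x => ∑ v ∈ V, x v) (by fun_prop)
  refine ⟨x, hx.2, fun x' hx' => ?_⟩
  rcases le_total (∑ v ∈ V, x' v) C with h | h
  · obtain ⟨x'', hx'', he⟩ := trunc x' hx' h
    rw [← he]
    exact hmin hx''
  · obtain ⟨x'', hx'', he⟩ := trunc x₀ hx₀ le_rfl
    refine le_trans ?_ h
    rw [hC, ← he]
    exact hmin hx''

/-- A direction in which no active constraint is violated does not improve an optimal solution. -/
theorem RMPOptimal.sum_direction_nonneg {V : Finset (RateVector I.F)} {x : RateVector I.F → ℝ}
    (hx : I.RMPOptimal V x) {d : RateVector I.F → ℝ}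
    (hsize : ∀ f, ∑ v ∈ V with 0 < v f, v f * d v = 0)
    (hdl : ∀ f, ((∑ v ∈ V with ∃ g ≤ f, 0 < v g, x v : ℝ) : WithTop ℝ) = I.deadline f →
      ∑ v ∈ V with ∃ g ≤ f, 0 < v g, d v ≤ 0)
    (hnn : ∀ v ∈ V, x v = 0 → 0 ≤ d v) : 0 ≤ ∑ v ∈ V, d v := by
  have hlim : ∀ a b : ℝ, Tendsto (fun ε : ℝ => a + ε * b) (𝓝[>] 0) (𝓝 a) := by
    intro a b
    have : Tendsto (fun ε : ℝ => a + ε * b) (𝓝 0) (𝓝 (a + 0 * b)) :=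
      Continuous.tendsto (by fun_prop) 0
    rw [zero_mul, add_zero] at this
    exact this.mono_left nhdsWithin_le_nhds
  have e1 : ∀ᶠ ε : ℝ in 𝓝[>] 0, ∀ f,
      ((∑ v ∈ V with ∃ g ≤ f, 0 < v g, (x v + ε * d v) : ℝ) : WithTop ℝ) ≤ I.deadline f := by
    rw [eventually_all]
    intro f
    simp only [Finset.sum_add_distrib, ← Finset.mul_sum]
    have hf := hx.1.deadline f
    rcases eq_or_lt_of_le hf with heq | hlt
    · filter_upwards [self_mem_nhdsWithin] with ε hε
      rw [← heq, WithTop.coe_le_coe]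
      have := mul_nonpos_of_nonneg_of_nonpos (le_of_lt (Set.mem_Ioi.mp hε)) (hdl f heq)
      linarith
    · by_cases htop : I.deadline f = ⊤
      · simp [htop]
      · obtain ⟨t, ht⟩ := WithTop.ne_top_iff_exists.mp htop
        rw [← ht, WithTop.coe_lt_coe] at hlt
        filter_upwards [(hlim _ (∑ v ∈ V with ∃ g ≤ f, 0 < v g, d v)).eventually
          (gt_mem_nhds hlt)] with ε hε
        rw [← ht, WithTop.coe_le_coe]
        exact hε.le
  have e2 : ∀ᶠ ε : ℝ in 𝓝[>] 0, ∀ v ∈ V, 0 ≤ x v + ε * d v := by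
    rw [Finset.eventually_all]
    intro v hv
    rcases eq_or_lt_of_le (hx.1.nonneg v hv) with heq | hlt
    · filter_upwards [self_mem_nhdsWithin] with ε hε
      rw [← heq, zero_add]
      exact mul_nonneg (le_of_lt hε) (hnn v hv heq.symm)
    · filter_upwards [(hlim (x v) (d v)).eventually (lt_mem_nhds hlt)] with ε hε
      exact hε.le
  obtain ⟨ε, ⟨h1, h2⟩, hε⟩ := ((e1.and e2).and self_mem_nhdsWithin).exists
  have hε : 0 < ε := hε
  have := hx.2 (fun v => x v + ε * d v) ⟨fun f => ?_, h1, h2⟩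
  · simp only [Finset.sum_add_distrib, ← Finset.mul_sum] at this
    exact nonneg_of_mul_nonneg_right (by linarith) hε
  · simp only [mul_add, Finset.sum_add_distrib, hx.1.size_eq f]
    have h0 : ∑ v ∈ V with 0 < v f, v f * (ε * d v) = ε * ∑ v ∈ V with 0 < v f, v f * d v := by
      rw [Finset.mul_sum]
      exact Finset.sum_congr rfl fun v _ => by ring
    rw [h0, hsize f, mul_zero, add_zero]

/-- Strong duality for the restricted master problem. -/
theorem RMPOptimal.exists_dual {V : Finset (RateVector I.F)} {x : RateVector I.F → ℝ}
    (hx : I.RMPOptimal V x) :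
    ∃ μ, I.DualFeasible V μ ∧ I.dualValue μ = ∑ v ∈ V, x v := by
  classical
  let E := RateVector I.F → ℝ
  obtain ⟨pr, hpr⟩ : ∃ pr : RateVector I.F → E →ₗ[ℝ] ℝ, ∀ v d, pr v d = d v :=
    ⟨fun v => LinearMap.proj v, fun _ _ => rfl⟩
  let sz : Fin I.F → E →ₗ[ℝ] ℝ := fun f => ∑ v ∈ V with 0 < v f, v f • pr v
  let dl : Fin I.F → E →ₗ[ℝ] ℝ := fun f => ∑ v ∈ V with ∃ g ≤ f, 0 < v g, pr v
  have hsz : ∀ f d, sz f d = ∑ v ∈ V with 0 < v f, v f * d v := fun f d => by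
    simp [sz, hpr, LinearMap.sum_apply]
  have hdl : ∀ f d, dl f d = ∑ v ∈ V with ∃ g ≤ f, 0 < v g, d v := fun f d => by
    simp [dl, hpr, LinearMap.sum_apply]
  -- The 0/1 factors `act` and `zer` turn inactive constraints into the zero functional, so that
  -- Farkas' lemma sees only active ones. They also build in complementary slackness, and `pi f = 0`
  -- for an infinite deadline.
  let act : Fin I.F → ℝ := fun f => if ((dl f x : ℝ) : WithTop ℝ) = I.deadline f then 1 else 0
  let zer : RateVector I.F → ℝ := fun v => if x v = 0 then 1 else 0
  let a : (Fin I.F ⊕ Fin I.F) ⊕ (Fin I.F ⊕ V) → E →ₗ[ℝ] ℝ :=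
    Sum.elim (Sum.elim sz fun f => - sz f) (Sum.elim (fun f => -(act f • dl f))
      fun v => zer v • pr v)
  obtain ⟨w, hw, hc⟩ := exists_nonneg_combination Finset.univ a (∑ v ∈ V, pr v) (by
    intro d hd
    have hd' : ∀ i, 0 ≤ a i d := fun i => hd i (Finset.mem_univ i)
    simp only [LinearMap.sum_apply, hpr]
    refine hx.sum_direction_nonneg (fun f => ?_) (fun f hf => ?_) fun v hv hxv => ?_
    · have h1 := hd' (.inl (.inl f))
      have h2 := hd' (.inl (.inr f))
      simp only [a, Sum.elim_inl, Sum.elim_inr, LinearMap.neg_apply] at h1 h2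
      rw [← hsz]
      linarith
    · have h1 := hd' (.inr (.inl f))
      rw [← hdl] at hf ⊢
      simp only [a, Sum.elim_inl, Sum.elim_inr, LinearMap.neg_apply, act,
        if_pos hf, one_smul] at h1
      linarith
    · have h1 := hd' (.inr (.inr ⟨v, hv⟩))
      simpa [a, zer, hpr, hxv] using h1)
  let μ : DualValues I.F :=
    ⟨fun f => w (.inl (.inl f)) - w (.inl (.inr f)), fun f => -(w (.inr (.inl f)) * act f)⟩
  have hc' : ∀ d : E, ∑ v ∈ V, d v = (∑ f, sz f d * μ.lam f) + (∑ f, dl f d * μ.pi f)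
      + ∑ v : V, w (.inr (.inr v)) * (zer v * d v) := by
    intro d
    have := hc d
    simp only [LinearMap.sum_apply, hpr, Fintype.sum_sum_type, a,
      Sum.elim_inl, Sum.elim_inr, LinearMap.neg_apply, LinearMap.smul_apply, smul_eq_mul] at this
    rw [this, ← Finset.sum_add_distrib, ← add_assoc]
    congr 2
    · exact Finset.sum_congr rfl fun f _ => by simp only [μ]; ring
    · exact Finset.sum_congr rfl fun f _ => by simp only [μ]; ring
  refine ⟨μ, ⟨fun v hv => ?_, fun f => ?_, fun f hf => ?_⟩, ?_⟩
  -- The multiplier identity at the unit vector of `v` is the dual constraint of `v`, with the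
  -- sign-constraint terms as its slack.
  · have h1 := hc' (Pi.single v 1)
    have h2 := sum_mul_columnValue V (Pi.single v 1) μ
    simp only [hsz, hdl] at h1
    rw [← h2] at h1
    have h3 : ∑ u ∈ V, (Pi.single v 1 : E) u = 1 := by
      rw [Finset.sum_eq_single_of_mem v hv fun u _ hu => Pi.single_eq_of_ne hu _,
        Pi.single_eq_same]
    have h4 : ∑ u ∈ V, (Pi.single v 1 : E) u * columnValue μ u = columnValue μ v := by
      rw [Finset.sum_eq_single_of_mem v hv fun u _ hu => by rw [Pi.single_eq_of_ne hu, zero_mul],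
        Pi.single_eq_same, one_mul]
    have h5 : 0 ≤ ∑ u : V, w (.inr (.inr u)) * (zer u * (Pi.single v 1 : E) u) := by
      refine Finset.sum_nonneg fun u _ => mul_nonneg (hw _) (mul_nonneg ?_ ?_)
      · simp only [zer]; split_ifs <;> norm_num
      · by_cases hu : (u : RateVector I.F) = v
        · rw [hu, Pi.single_eq_same]; norm_num
        · rw [Pi.single_eq_of_ne hu]
    rw [h3, h4] at h1
    show columnValue μ v ≤ 1
    linarith
  · have : 0 ≤ act f := by simp only [act]; split_ifs <;> norm_num
    simp only [μ, neg_nonpos]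
    exact mul_nonneg (hw _) this
  · simp [μ, act, hf]
  -- At `x` itself the sign-constraint terms vanish and only tight deadlines carry weight, so the
  -- identity equates the two objective values.
  · rw [hc' x, dualValue]
    have h3 : ∑ v : V, w (.inr (.inr v)) * (zer v * x v) = 0 :=
      Finset.sum_eq_zero fun v _ => by
        by_cases h : x v = 0 <;> simp [zer, h]
    rw [h3, add_zero]
    congr 1
    · exact Finset.sum_congr rfl fun f _ => by rw [hsz, hx.1.size_eq]
    · refine Finset.sum_congr rfl fun f _ => ?_
      by_cases hf : ((dl f x : ℝ) : WithTop ℝ) = I.deadline f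
      · rw [← hf, WithTop.untopD_coe]
      · simp [μ, act, hf]

theorem RMPOptimal.exists_dualOptimal {V : Finset (RateVector I.F)} {x : RateVector I.F → ℝ}
    (hx : I.RMPOptimal V x) : ∃ μ, I.DualOptimal V μ := by
  obtain ⟨μ, hμ, he⟩ := hx.exists_dual
  exact ⟨μ, hμ, fun μ' hμ' => he ▸ hx.1.dualValue_le_sum hμ'⟩

theorem RMPOptimal.dualValue_eq {V : Finset (RateVector I.F)} {x : RateVector I.F → ℝ}
    (hx : I.RMPOptimal V x) {μ : DualValues I.F} (hμ : I.DualOptimal V μ) :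
    I.dualValue μ = ∑ v ∈ V, x v := by
  obtain ⟨μ', hμ', he⟩ := hx.exists_dual
  exact le_antisymm (hx.1.dualValue_le_sum hμ.1) (he ▸ hμ.2 μ' hμ')

/-- By complementary slackness, some column of the master problem has reduced cost `0`. -/
theorem RMPOptimal.exists_columnValue_eq_one {V : Finset (RateVector I.F)}
    {x : RateVector I.F → ℝ} (hx : I.RMPOptimal V x) {μ : DualValues I.F}
    (hμ : I.DualOptimal V μ) : ∃ v ∈ V, columnValue μ v = 1 := by
  obtain ⟨v, hv, hxv⟩ : ∃ v ∈ V, x v ≠ 0 := by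
    by_contra! h
    have h1 := hx.1.size_eq ⟨0, I.F_pos⟩
    rw [Finset.sum_eq_zero fun v hv => by rw [h v (Finset.mem_filter.mp hv).1, mul_zero]] at h1
    exact (I.size_pos _).ne h1
  refine ⟨v, hv, ?_⟩
  have h1 : ∑ v ∈ V, x v ≤ ∑ v ∈ V, x v * columnValue μ v :=
    hx.dualValue_eq hμ ▸ hx.1.dualValue_le hμ.1.pi_nonpos hμ.1.pi_eq_zero
  have h2 : ∀ v ∈ V, x v * columnValue μ v ≤ x v := fun v hv =>
    mul_le_of_le_one_right (hx.1.nonneg v hv) (hμ.1.columnValue_le hv)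
  have h3 := (Finset.sum_eq_sum_iff_of_le h2).mp (le_antisymm (Finset.sum_le_sum h2) h1) v hv
  exact mul_left_cancel₀ hxv (by rw [h3, mul_one])

end IFDP

/-! ### Durations and end times in schedules -/

namespace Schedule

variable {F : ℕ}

theorem endTime_cons_succ (p : Period F) (σ : Schedule F) (i : Fin σ.length) :
    endTime (p :: σ) i.succ = p.dur + endTime σ i := by
  simp [endTime]

theorem endTime_cons_zero (p : Period F) (σ : Schedule F) :
    endTime (p :: σ) (0 : Fin (σ.length + 1)) = p.dur := by
  simp [endTime]

theorem endTime_le_completionTime (σ : Schedule F) {i : Fin σ.length} {f : Fin F}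
    (h : 0 < (σ.get i).rate f) : endTime σ i ≤ completionTime σ f :=
  le_ciSup (f := fun p : {p : Fin σ.length // 0 < (σ.get p).rate f} => endTime σ p.1)
    (Set.finite_range _).bddAbove ⟨i, h⟩

theorem completionTime_le_makespan (σ : Schedule F) (f : Fin F) :
    completionTime σ f ≤ makespan σ :=
  le_ciSup (f := fun f => completionTime σ f) (Set.finite_range _).bddAbove f

/-- The periods with the property `P` last no longer than until the end of the last of them. -/
theorem exists_sum_le_endTime (P : Period F → Prop) [DecidablePred P] :
    ∀ σ : Schedule F, (∀ p ∈ σ, 0 < p.dur) → (∃ p ∈ σ, P p) →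
      ∃ i : Fin σ.length, P (σ.get i) ∧
        (σ.map fun p => if P p then p.dur else 0).sum ≤ endTime σ i
  | [], _, h => by simp at h
  | p :: σ, hd, h => by
    have hp : 0 < p.dur := hd p (by simp)
    by_cases hσ : ∃ p ∈ σ, P p
    · obtain ⟨i, hi, hle⟩ :=
        exists_sum_le_endTime P σ (fun q hq => hd q (List.mem_cons_of_mem _ hq)) hσ
      refine ⟨i.succ, by simpa using hi, ?_⟩
      rw [endTime_cons_succ, List.map_cons, List.sum_cons]
      refine add_le_add ?_ hle
      split_ifs
      · exact le_rfl
      · exact hp.le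
    · have hpP : P p := by
        obtain ⟨q, hq, hqP⟩ := h
        rcases List.mem_cons.mp hq with rfl | hq
        · exact hqP
        · exact absurd ⟨q, hq, hqP⟩ hσ
      refine ⟨(0 : Fin (σ.length + 1)), by simpa using hpP, ?_⟩
      rw [endTime_cons_zero, List.map_cons, List.sum_cons, if_pos hpP, add_le_iff_nonpos_right]
      refine le_of_eq (List.sum_eq_zero fun y hy => ?_)
      obtain ⟨q, hq, rfl⟩ := List.mem_map.mp hy
      exact if_neg fun hqP => hσ ⟨q, hq, hqP⟩

/-- If the periods are sorted by the key `k`, then a period ends no later than the total duration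
of the periods whose key is not larger. -/
theorem endTime_le_sum (k : Period F → ℕ) :
    ∀ σ : Schedule F, (∀ p ∈ σ, 0 < p.dur) → σ.Pairwise (fun p q => k p ≤ k q) →
      ∀ (i : Fin σ.length) (n : ℕ), k (σ.get i) ≤ n →
        endTime σ i ≤ (σ.map fun p => if k p ≤ n then p.dur else 0).sum
  | [], _, _ => fun i => i.elim0
  | p :: σ, hd, hs => by
    have hd' : ∀ q ∈ σ, 0 < q.dur := fun q hq => hd q (List.mem_cons_of_mem _ hq)
    obtain ⟨hs1, hs2⟩ := List.pairwise_cons.mp hs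
    intro i n hn
    rw [List.map_cons, List.sum_cons]
    refine Fin.cases (motive := fun i => k ((p :: σ).get i) ≤ n → endTime (p :: σ) i ≤ _)
      (fun hn => ?_) (fun j hn => ?_) i hn
    · have hn : k p ≤ n := by simpa using hn
      refine (endTime_cons_zero p σ).trans_le ?_
      rw [if_pos hn, le_add_iff_nonneg_right]
      refine List.sum_nonneg fun y hy => ?_
      obtain ⟨q, hq, rfl⟩ := List.mem_map.mp hy
      split_ifs
      · exact (hd' q hq).le
      · exact le_rfl
    · have hn : k (σ.get j) ≤ n := by simpa using hn
      rw [endTime_cons_succ, if_pos ((hs1 _ (List.get_mem σ j)).trans hn)]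
      exact add_le_add le_rfl (endTime_le_sum k σ hd' hs2 j n hn)

/-- The total time for which the rate vector `v` is used. -/
noncomputable def usage (σ : Schedule F) (v : RateVector F) : ℝ :=
  (σ.map fun p => if p.rate = v then p.dur else 0).sum

/-- The rate vectors in use. -/
noncomputable def rates (σ : Schedule F) : Finset (RateVector F) :=
  (σ.map Period.rate).toFinset

theorem rate_mem_rates {σ : Schedule F} {p : Period F} (hp : p ∈ σ) : p.rate ∈ rates σ :=
  List.mem_toFinset.mpr (List.mem_map_of_mem hp)

theorem exists_of_mem_rates {σ : Schedule F} {v : RateVector F} (hv : v ∈ rates σ) :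
    ∃ p ∈ σ, p.rate = v :=
  List.mem_map.mp (List.mem_toFinset.mp hv)

theorem sum_mul_usage (V : Finset (RateVector F)) (g : RateVector F → ℝ) :
    ∀ σ : Schedule F, (∀ p ∈ σ, p.rate ∈ V) →
      ∑ v ∈ V, g v * usage σ v = (σ.map fun p => g p.rate * p.dur).sum
  | [], _ => by simp [usage]
  | p :: σ, h => by
    rw [List.map_cons, List.sum_cons,
      ← sum_mul_usage V g σ fun q hq => h q (List.mem_cons_of_mem _ hq)]
    simp only [usage, List.map_cons, List.sum_cons, mul_add, Finset.sum_add_distrib]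
    congr 1
    rw [Finset.sum_eq_single_of_mem p.rate (h p (by simp)) fun v _ hv => by
      rw [if_neg (Ne.symm hv), mul_zero], if_pos rfl]

theorem sum_filter_usage (σ : Schedule F) (P : RateVector F → Prop) [DecidablePred P] :
    ∑ v ∈ rates σ with P v, usage σ v
      = (σ.map fun p => if P p.rate then p.dur else 0).sum := by
  rw [Finset.sum_filter]
  have := sum_mul_usage (rates σ) (fun v => if P v then 1 else 0) σ fun p hp => rate_mem_rates hp
  simpa using this

theorem usage_nonneg {σ : Schedule F} (hd : ∀ p ∈ σ, 0 < p.dur) (v : RateVector F) :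
    0 ≤ usage σ v := by
  refine List.sum_nonneg fun y hy => ?_
  obtain ⟨q, hq, rfl⟩ := List.mem_map.mp hy
  split_ifs
  · exact (hd q hq).le
  · exact le_rfl

end Schedule

/-! ### Schedules versus master solutions -/

namespace IFDP

open Schedule

variable {Node : Type*} [Fintype Node] [DecidableEq Node] {I : IFDP Node}

theorem nonneg_of_mem_rateVectors {v : RateVector I.F} (hv : v ∈ I.rateVectors) (f : Fin I.F) :
    0 ≤ v f := by
  obtain ⟨y, z, h⟩ := hv
  exact h.rate_nonneg f

theorem exists_pos_of_delivered_eq {σ : Schedule I.F} (hr : ∀ p ∈ σ, p.rate ∈ I.rateVectors)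
    {f : Fin I.F} (hf : delivered σ f = I.size f) : ∃ p ∈ σ, 0 < p.rate f := by
  by_contra! h
  refine (I.size_pos f).ne (hf ▸ Eq.symm (List.sum_eq_zero fun y hy => ?_))
  obtain ⟨q, hq, rfl⟩ := List.mem_map.mp hy
  rw [le_antisymm (h q hq) (nonneg_of_mem_rateVectors (hr q hq) f), mul_zero]

/-- The last period that serves some flow `g ≤ f` ends no later than the completion time of that
`g`, hence by its deadline, which is at most that of `f`. -/
theorem IsFeasible.rmpFeasible {σ : Schedule I.F} (h : I.IsFeasible σ) :
    I.RMPFeasible (rates σ) (usage σ) := by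
  refine ⟨fun f => ?_, fun f => ?_, fun v _ => usage_nonneg h.dur_pos v⟩
  · rw [← h.delivered_eq f, delivered, Finset.sum_filter]
    have h1 := sum_mul_usage (rates σ) (fun v => v f) σ fun p hp => rate_mem_rates hp
    simp only [mul_comm (Period.dur _)]
    rw [← h1]
    refine Finset.sum_congr rfl fun v hv => ?_
    obtain ⟨p, hp, rfl⟩ := exists_of_mem_rates hv
    split_ifs with hpos
    · rfl
    · rw [le_antisymm (not_lt.mp hpos) (nonneg_of_mem_rateVectors (h.rate_mem p hp) f), zero_mul]
  · obtain ⟨p, hp, hpos⟩ := exists_pos_of_delivered_eq h.rate_mem (h.delivered_eq f)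
    obtain ⟨i, ⟨g, hgf, hg⟩, hle⟩ := exists_sum_le_endTime
      (fun p : Period I.F => ∃ g ≤ f, 0 < p.rate g) σ h.dur_pos ⟨p, hp, f, le_rfl, hpos⟩
    rw [sum_filter_usage]
    exact (WithTop.coe_le_coe.mpr (hle.trans (endTime_le_completionTime σ hg))).trans
      ((h.deadline g).trans (I.deadline_mono hgf))

/-- Idle periods must be left out: the makespan ends with the last positive rate, so trailing idle
time is not counted in it. -/
theorem IsFeasible.sum_usage_le_makespan {σ : Schedule I.F} (h : I.IsFeasible σ) :
    ∑ v ∈ rates σ with ∃ f, 0 < v f, usage σ v ≤ makespan σ := by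
  obtain ⟨p, hp, hpos⟩ := exists_pos_of_delivered_eq h.rate_mem (h.delivered_eq ⟨0, I.F_pos⟩)
  obtain ⟨i, ⟨g, hg⟩, hle⟩ := exists_sum_le_endTime
    (fun p : Period I.F => ∃ g, 0 < p.rate g) σ h.dur_pos ⟨p, hp, _, hpos⟩
  rw [sum_filter_usage]
  exact hle.trans ((endTime_le_completionTime σ hg).trans (completionTime_le_makespan σ g))

/-- Dual values that are feasible for all rate vectors bound the overall completion time. -/
theorem IsFeasible.dualValue_le_makespan {σ : Schedule I.F} (h : I.IsFeasible σ)
    {μ : DualValues I.F} (hpi : ∀ f, μ.pi f ≤ 0) (htop : ∀ f, I.deadline f = ⊤ → μ.pi f = 0)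
    (hcol : ∀ v ∈ I.rateVectors, columnValue μ v ≤ 1) : I.dualValue μ ≤ makespan σ := by
  refine (h.rmpFeasible.dualValue_le hpi htop).trans (le_trans ?_ h.sum_usage_le_makespan)
  rw [Finset.sum_filter]
  refine Finset.sum_le_sum fun v hv => ?_
  split_ifs with hpos
  · obtain ⟨p, hp, rfl⟩ := exists_of_mem_rates hv
    exact mul_le_of_le_one_right (usage_nonneg h.dur_pos _) (hcol _ (h.rate_mem p hp))
  · rw [columnValue_eq_zero μ hpos, mul_zero]

theorem exists_isConstructedSchedule (V : Finset (RateVector I.F)) (x : RateVector I.F → ℝ) :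
    ∃ σ, I.IsConstructedSchedule V x σ :=
  ⟨_, fun f => (I.firstClass V x f).toList, fun _ => ⟨Finset.nodup_toList _,
    Finset.toList_toFinset _⟩, rfl⟩

namespace IsConstructedSchedule

variable {V : Finset (RateVector I.F)} {x : RateVector I.F → ℝ} {σ : Schedule I.F}

theorem exists_of_mem (hσ : I.IsConstructedSchedule V x σ) {p : Period I.F} (hp : p ∈ σ) :
    p.rate ∈ V ∧ 0 < x p.rate ∧ firstFlow p.rate < I.F ∧ p.dur = x p.rate := by
  obtain ⟨q, hq, rfl⟩ := hσ
  obtain ⟨f, -, hf⟩ := List.mem_flatMap.mp hp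
  obtain ⟨v, hv, rfl⟩ := List.mem_map.mp hf
  have hv' : v ∈ I.firstClass V x f := (hq f).2 ▸ List.mem_toFinset.mpr hv
  obtain ⟨h1, h2, h3⟩ := Finset.mem_filter.mp hv'
  exact ⟨h1, h2, h3 ▸ f.2, rfl⟩

theorem sorted (hσ : I.IsConstructedSchedule V x σ) :
    σ.Pairwise fun p p' => firstFlow p.rate ≤ firstFlow p'.rate := by
  obtain ⟨q, hq, rfl⟩ := hσ
  have key : ∀ f, ∀ p ∈ (q f).map (fun v => (⟨x v, v⟩ : Period I.F)), firstFlow p.rate = f := by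
    intro f p hp
    obtain ⟨v, hv, rfl⟩ := List.mem_map.mp hp
    have hv' : v ∈ I.firstClass V x f := (hq f).2 ▸ List.mem_toFinset.mpr hv
    exact (Finset.mem_filter.mp hv').2.2
  rw [List.pairwise_flatMap]
  refine ⟨fun f _ => List.pairwise_of_forall_mem_list fun p hp p' hp' => ?_, ?_⟩
  · rw [key f p hp, key f p' hp']
  · refine (List.pairwise_lt_finRange I.F).imp fun {f g} hfg p hp p' hp' => ?_
    rw [key f p hp, key g p' hp']
    exact le_of_lt hfg

/-- Each used nonzero column lies in exactly one class. Columns without a positive rate lie in none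
and are dropped, whence the condition `firstFlow v < I.F`. -/
theorem sum_map (hσ : I.IsConstructedSchedule V x σ) (g : Period I.F → ℝ) :
    (σ.map g).sum = ∑ v ∈ V with 0 < x v ∧ firstFlow v < I.F, g ⟨x v, v⟩ := by
  obtain ⟨q, hq, rfl⟩ := hσ
  have h1 : ∀ f, (((q f).map fun v => (⟨x v, v⟩ : Period I.F)).map g).sum
      = ∑ v ∈ I.firstClass V x f, g ⟨x v, v⟩ := by
    intro f
    rw [← (hq f).2, List.sum_toFinset _ (hq f).1, List.map_map]
    rfl
  have h2 : ∀ l : List (Fin I.F),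
      ((l.flatMap fun f => (q f).map fun v => (⟨x v, v⟩ : Period I.F)).map g).sum
        = (l.map fun f => ∑ v ∈ I.firstClass V x f, g ⟨x v, v⟩).sum := by
    intro l
    induction l with
    | nil => simp
    | cons f l ih => rw [List.flatMap_cons, List.map_append, List.sum_append, ih, h1]; simp
  rw [h2, ← List.ofFn_eq_map, List.sum_ofFn]
  simp only [firstClass]
  simp only [Finset.sum_filter]
  rw [Finset.sum_comm]
  refine Finset.sum_congr rfl fun v _ => ?_
  by_cases hx : 0 < x v
  · by_cases hv : firstFlow v < I.F
    · rw [Finset.sum_eq_single_of_mem ⟨firstFlow v, hv⟩ (Finset.mem_univ _)]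
      · simp [hx, hv]
      · intro f _ hf
        exact if_neg fun h => hf (Fin.ext h.2.symm)
    · rw [if_neg fun h => hv h.2]
      exact Finset.sum_eq_zero fun f _ => if_neg fun h : 0 < x v ∧ firstFlow v = f => hv (h.2 ▸ f.2)
  · simp [hx]

theorem dur_pos (hσ : I.IsConstructedSchedule V x σ) : ∀ p ∈ σ, 0 < p.dur := by
  intro p hp
  obtain ⟨-, h, -, he⟩ := hσ.exists_of_mem hp
  exact he ▸ h

theorem endTime_le (hσ : I.IsConstructedSchedule V x σ) (hx : ∀ v ∈ V, 0 ≤ x v)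
    {i : Fin σ.length} {f : Fin I.F} (h : 0 < (σ.get i).rate f) :
    endTime σ i ≤ ∑ v ∈ V with ∃ g ≤ f, 0 < v g, x v := by
  refine (endTime_le_sum (fun p => firstFlow p.rate) σ hσ.dur_pos hσ.sorted i f
    (firstFlow_le_of_pos h)).trans ?_
  rw [hσ.sum_map, Finset.sum_filter, Finset.sum_filter]
  simp only [exists_pos_iff_firstFlow_le]
  refine Finset.sum_le_sum fun v hv => ?_
  have := hx v hv
  split_ifs <;> simp_all

theorem delivered_eq (hσ : I.IsConstructedSchedule V x σ) (hx : I.RMPFeasible V x)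
    (hV : ∀ v ∈ V, v ∈ I.rateVectors) (f : Fin I.F) : delivered σ f = I.size f := by
  rw [delivered, hσ.sum_map, ← hx.size_eq f, Finset.sum_filter, Finset.sum_filter]
  refine Finset.sum_congr rfl fun v hv => ?_
  by_cases hf : 0 < v f
  · rw [if_pos hf]
    rcases eq_or_lt_of_le (hx.nonneg v hv) with h | h
    · simp [← h]
    · rw [if_pos ⟨h, (firstFlow_le_of_pos hf).trans_lt f.2⟩, mul_comm]
  · simp [le_antisymm (not_lt.mp hf) (nonneg_of_mem_rateVectors (hV v hv) f)]

theorem completionTime_le (hσ : I.IsConstructedSchedule V x σ) (hx : I.RMPFeasible V x)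
    (hV : ∀ v ∈ V, v ∈ I.rateVectors) (f : Fin I.F) :
    completionTime σ f ≤ ∑ v ∈ V with ∃ g ≤ f, 0 < v g, x v := by
  obtain ⟨p, hp, hpos⟩ := exists_pos_of_delivered_eq
    (fun p hp => hV _ (hσ.exists_of_mem hp).1) (hσ.delivered_eq hx hV f)
  obtain ⟨i, rfl⟩ := List.get_of_mem hp
  -- Positive size forces a period that serves `f`, so the supremum is not the default value of an
  -- empty one.
  have : Nonempty {p : Fin σ.length // 0 < (σ.get p).rate f} := ⟨⟨i, hpos⟩⟩
  exact ciSup_le fun j => hσ.endTime_le hx.nonneg j.2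

theorem isFeasible (hσ : I.IsConstructedSchedule V x σ) (hx : I.RMPFeasible V x)
    (hV : ∀ v ∈ V, v ∈ I.rateVectors) : I.IsFeasible σ :=
  ⟨hσ.dur_pos, fun _ hp => hV _ (hσ.exists_of_mem hp).1, hσ.delivered_eq hx hV, fun f =>
    (WithTop.coe_le_coe.mpr (hσ.completionTime_le hx hV f)).trans (hx.deadline f)⟩

theorem makespan_le (hσ : I.IsConstructedSchedule V x σ) (hx : I.RMPFeasible V x)
    (hV : ∀ v ∈ V, v ∈ I.rateVectors) : makespan σ ≤ ∑ v ∈ V, x v := by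
  have : Nonempty (Fin I.F) := ⟨⟨0, I.F_pos⟩⟩
  exact ciSup_le fun f => (hσ.completionTime_le hx hV f).trans <|
    Finset.sum_le_sum_of_subset_of_nonneg (Finset.filter_subset _ _) fun v hv _ => hx.nonneg v hv

/-- The makespan is at most the master value, which equals the dual value, and the latter bounds
every feasible makespan because the dual constraints hold on all rate vectors. -/
theorem isOptimal (hσ : I.IsConstructedSchedule V x σ) (hx : I.RMPOptimal V x)
    (hV : ∀ v ∈ V, v ∈ I.rateVectors) {μ : DualValues I.F} (hμ : I.DualOptimal V μ)
    (hcol : ∀ v ∈ I.rateVectors, columnValue μ v ≤ 1) : I.IsOptimal σ :=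
  ⟨hσ.isFeasible hx.1 hV, fun _ h =>
    ((hσ.makespan_le hx.1 hV).trans_eq (hx.dualValue_eq hμ).symm).trans
    (h.dualValue_le_makespan hμ.1.pi_nonpos hμ.1.pi_eq_zero hcol)⟩

end IsConstructedSchedule

theorem exists_isInitial_iff : (∃ V₀, I.IsInitial V₀) ↔ ∃ σ, I.IsFeasible σ := by
  constructor
  · rintro ⟨V, hV, x, hx⟩
    obtain ⟨σ, hσ⟩ := exists_isConstructedSchedule V x
    exact ⟨σ, hσ.isFeasible hx hV⟩
  · rintro ⟨σ, hσ⟩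
    refine ⟨rates σ, fun v hv => ?_, _, hσ.rmpFeasible⟩
    obtain ⟨p, hp, rfl⟩ := exists_of_mem_rates hv
    exact hσ.rate_mem p hp

end IFDP

/-! ### Compactness and solvability of the subproblems -/

namespace IFDP

open Filter Topology

variable {Node : Type*} [Fintype Node] [DecidableEq Node] {I : IFDP Node}

theorem realizes_zero : I.Realizes 0 0 0 where
  balance f i := by simp
  arc_rate_le f a := by simp
  alloc_le a := by simpa using I.cap_nonneg a
  rate_nonneg f := le_rfl
  arc_rate_nonneg f a := le_rfl

section Bounds

variable {r : RateVector I.F} {y : Fin I.F → I.arcs → ℝ} {z : Fin I.F → I.arcs → Fin I.k → ℕ}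

theorem unit_mul_nonneg (f : Fin I.F) (a : I.arcs) (m : Fin I.k) :
    0 ≤ I.unit m * (z f a m : ℝ) :=
  mul_nonneg (I.unit_pos m).le (Nat.cast_nonneg _)

theorem Realizes.alloc_le_cap (h : I.Realizes r y z) (f : Fin I.F) (a : I.arcs) :
    ∑ m, I.unit m * (z f a m : ℝ) ≤ I.cap a :=
  (Finset.single_le_sum (f := fun f => ∑ m, I.unit m * (z f a m : ℝ))
    (fun f _ => Finset.sum_nonneg fun m _ => unit_mul_nonneg f a m)
    (Finset.mem_univ f)).trans (h.alloc_le a)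

theorem Realizes.arc_rate_le_cap (h : I.Realizes r y z) (f : Fin I.F) (a : I.arcs) :
    y f a ≤ I.cap a :=
  (h.arc_rate_le f a).trans (h.alloc_le_cap f a)

theorem Realizes.rate_le (h : I.Realizes r y z) (f : Fin I.F) : r f ≤ ∑ a, I.cap a := by
  have hb := h.balance f (I.origin f)
  rw [if_pos rfl] at hb
  have h1 : 0 ≤ ∑ a : I.arcs with a.1.2 = I.origin f, y f a :=
    Finset.sum_nonneg fun a _ => h.arc_rate_nonneg f a
  have h2 : ∑ a : I.arcs with a.1.1 = I.origin f, y f a ≤ ∑ a, y f a :=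
    Finset.sum_le_sum_of_subset_of_nonneg (Finset.filter_subset _ _)
      fun a _ _ => h.arc_rate_nonneg f a
  have h3 : ∑ a, y f a ≤ ∑ a, I.cap a := Finset.sum_le_sum fun a _ => h.arc_rate_le_cap f a
  linarith

variable (I) in
/-- An upper bound on the number of times a capacity unit can be allocated. -/
noncomputable def allocBound : ℕ := ∑ a, ∑ m, ⌈I.cap a / I.unit m⌉₊

theorem Realizes.alloc_le_allocBound (h : I.Realizes r y z) (f : Fin I.F) (a : I.arcs)
    (m : Fin I.k) : z f a m ≤ I.allocBound := by
  have h1 : I.unit m * (z f a m : ℝ) ≤ I.cap a :=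
    (Finset.single_le_sum (f := fun m => I.unit m * (z f a m : ℝ))
      (fun m _ => unit_mul_nonneg f a m) (Finset.mem_univ m)).trans (h.alloc_le_cap f a)
  have h2 : (z f a m : ℝ) ≤ I.cap a / I.unit m := by
    rw [le_div_iff₀ (I.unit_pos m), mul_comm]
    exact h1
  have h3 : z f a m ≤ ⌈I.cap a / I.unit m⌉₊ := by exact_mod_cast h2.trans (Nat.le_ceil _)
  refine h3.trans ((Finset.single_le_sum (f := fun m => ⌈I.cap a / I.unit m⌉₊)
    (fun _ _ => Nat.zero_le _) (Finset.mem_univ m)).trans ?_)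
  exact Finset.single_le_sum (f := fun a => ∑ m, ⌈I.cap a / I.unit m⌉₊)
    (fun _ _ => Nat.zero_le _) (Finset.mem_univ a)

end Bounds

theorem isCompact_setOf_spFeasible (fp : ℕ) (z : Fin I.F → I.arcs → Fin I.k → ℕ) :
    IsCompact {q : RateVector I.F × (Fin I.F → I.arcs → ℝ) | I.SPFeasible fp q.1 q.2 z} := by
  refine IsCompact.of_isClosed_subset (isCompact_Icc (a := 0)
    (b := ((fun _ => ∑ a, I.cap a, fun _ => I.cap) :
      RateVector I.F × (Fin I.F → I.arcs → ℝ)))) ?_ ?_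
  · have h1 : IsClosed {q : RateVector I.F × (Fin I.F → I.arcs → ℝ) | ∀ f i,
        (∑ a : I.arcs with a.1.1 = i, q.2 f a) - (∑ a : I.arcs with a.1.2 = i, q.2 f a)
          = if i = I.origin f then q.1 f else if i = I.dest f then -q.1 f else 0} := by
      simp only [Set.ofPred_forall]
      refine isClosed_iInter fun f => isClosed_iInter fun i => isClosed_eq (by fun_prop) ?_
      split_ifs <;> fun_prop
    have h2 : IsClosed {q : RateVector I.F × (Fin I.F → I.arcs → ℝ) |
        ∀ f a, q.2 f a ≤ ∑ m, I.unit m * (z f a m : ℝ)} := by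
      simp only [Set.ofPred_forall]
      exact isClosed_iInter fun f => isClosed_iInter fun a => isClosed_le (by fun_prop) (by fun_prop)
    have h3 : IsClosed {_q : RateVector I.F × (Fin I.F → I.arcs → ℝ) |
        ∀ a, ∑ f, ∑ m, I.unit m * (z f a m : ℝ) ≤ I.cap a} := isClosed_const
    have h4 : IsClosed {q : RateVector I.F × (Fin I.F → I.arcs → ℝ) | ∀ f, 0 ≤ q.1 f} := by
      simp only [Set.ofPred_forall]
      exact isClosed_iInter fun f => isClosed_le (by fun_prop) (by fun_prop)
    have h5 : IsClosed {q : RateVector I.F × (Fin I.F → I.arcs → ℝ) | ∀ f a, 0 ≤ q.2 f a} := by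
      simp only [Set.ofPred_forall]
      exact isClosed_iInter fun f => isClosed_iInter fun a => isClosed_le (by fun_prop) (by fun_prop)
    have h6 : IsClosed {q : RateVector I.F × (Fin I.F → I.arcs → ℝ) |
        ∀ f : Fin I.F, (f : ℕ) < fp → q.1 f = 0} := by
      simp only [Set.ofPred_forall]
      exact isClosed_iInter fun f => isClosed_iInter fun _ => isClosed_eq (by fun_prop) (by fun_prop)
    convert ((((h1.inter h2).inter h3).inter h4).inter h5).inter h6 using 1
    ext q
    exact ⟨fun h => ⟨⟨⟨⟨⟨h.1.1, h.1.2⟩, h.1.3⟩, h.1.4⟩, h.1.5⟩, h.2⟩,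
      fun h => ⟨⟨h.1.1.1.1.1, h.1.1.1.1.2, h.1.1.1.2, h.1.1.2, h.1.2⟩, h.2⟩⟩
  · rintro ⟨r, y⟩ ⟨h, -⟩
    exact ⟨⟨fun f => h.rate_nonneg f, fun f a => h.arc_rate_nonneg f a⟩,
      ⟨fun f => h.rate_le f, fun f a => h.arc_rate_le_cap f a⟩⟩

/-- Every subproblem has an optimal rate vector. -/
theorem exists_spOptimal (μ : DualValues I.F) (fp : ℕ) : ∃ r, I.SPOptimal μ fp r := by
  have hfin : {z : Fin I.F → I.arcs → Fin I.k → ℕ | ∀ f a m, z f a m ≤ I.allocBound}.Finite := by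
    refine (Set.finite_Iic (fun _ _ _ => I.allocBound :
      Fin I.F → I.arcs → Fin I.k → ℕ)).subset fun z hz f a m => hz f a m
  -- Positive units and finite capacities leave finitely many allocations, and each fixed one leaves
  -- a compact polytope of rates.
  have hK := hfin.isCompact_biUnion fun z _ => isCompact_setOf_spFeasible (I := I) fp z
  obtain ⟨q, hq, hmin⟩ := hK.exists_isMinOn
    (f := fun q : RateVector I.F × (Fin I.F → I.arcs → ℝ) => I.spObjective μ fp q.1)
    ⟨(0, 0), Set.mem_biUnion (x := 0) (fun _ _ _ => Nat.zero_le _)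
      ⟨realizes_zero, fun _ _ => rfl⟩⟩ (by unfold spObjective; fun_prop)
  obtain ⟨z, -, hz⟩ := Set.mem_iUnion₂.mp hq
  refine ⟨q.1, ⟨q.2, z, hz⟩, fun r' y' z' h => ?_⟩
  exact hmin (a := (r', y'))
    (Set.mem_biUnion (x := z') (fun f a m => h.1.alloc_le_allocBound f a m) h)

/-! ### Combinatorial types of rate vectors -/

variable (I) in
/-- The combinatorial type of a realized rate vector: the allocation of capacity units together
with the inequalities that hold with equality. -/
abbrev Profile : Type _ :=
  (Fin I.F → I.arcs → Fin I.k → Fin (I.allocBound + 1)) × (Fin I.F → Prop) ×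
    (Fin I.F → I.arcs → Prop) × (Fin I.F → I.arcs → Prop)

/-- The combinatorial type of a rate vector realized by `y` and `z`. -/
noncomputable def profile (r : RateVector I.F) (y : Fin I.F → I.arcs → ℝ)
    (z : Fin I.F → I.arcs → Fin I.k → ℕ) : I.Profile :=
  (fun f a m => Fin.ofNat _ (z f a m), fun f => r f = 0, fun f a => y f a = 0,
    fun f a => y f a = ∑ m, I.unit m * (z f a m : ℝ))

/-- A rate vector can be moved beyond another one of the same combinatorial type. -/
theorem Realizes.exists_extrapolation {r r' : RateVector I.F} {y y' : Fin I.F → I.arcs → ℝ}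
    {z z' : Fin I.F → I.arcs → Fin I.k → ℕ} (h : I.Realizes r y z) (h' : I.Realizes r' y' z')
    (hp : profile r y z = profile r' y' z') :
    ∃ ε > 0, ∃ y'', I.Realizes (fun f => r f + ε * (r f - r' f)) y'' z := by
  simp only [profile, Prod.mk.injEq, funext_iff, eq_iff_iff] at hp
  obtain ⟨hz, hr, hy, hu⟩ := hp
  -- Reduction modulo `allocBound + 1` loses nothing, as both allocations are within the bound.
  obtain rfl : z = z' := by
    funext f a m
    have := congrArg Fin.val (hz f a m)
    rwa [Fin.val_ofNat, Fin.val_ofNat,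
      Nat.mod_eq_of_lt (Nat.lt_succ_of_le (h.alloc_le_allocBound f a m)),
      Nat.mod_eq_of_lt (Nat.lt_succ_of_le (h'.alloc_le_allocBound f a m))] at this
  -- Read `a` and `b` as the slacks of one inequality at the two points: if zero, they vanish
  -- together and stay zero; a positive slack survives a small step.
  have key : ∀ a b : ℝ, 0 ≤ a → (a = 0 ↔ b = 0) →
      ∀ᶠ ε : ℝ in 𝓝[>] 0, 0 ≤ a + ε * (a - b) := by
    intro a b ha hab
    rcases eq_or_lt_of_le ha with h0 | h0
    · rw [hab.mp h0.symm, ← h0]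
      simp
    · have : Tendsto (fun ε : ℝ => a + ε * (a - b)) (𝓝 0) (𝓝 (a + 0 * (a - b))) :=
        Continuous.tendsto (by fun_prop) 0
      rw [zero_mul, add_zero] at this
      filter_upwards [(this.mono_left nhdsWithin_le_nhds).eventually (lt_mem_nhds h0)] with ε hε
      exact hε.le
  have e1 : ∀ᶠ ε : ℝ in 𝓝[>] 0, ∀ f, 0 ≤ r f + ε * (r f - r' f) :=
    eventually_all.mpr fun f => key _ _ (h.rate_nonneg f) (hr f)
  have e2 : ∀ᶠ ε : ℝ in 𝓝[>] 0, ∀ f a, 0 ≤ y f a + ε * (y f a - y' f a) :=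
    eventually_all.mpr fun f => eventually_all.mpr fun a =>
      key _ _ (h.arc_rate_nonneg f a) (hy f a)
  have e3 : ∀ᶠ ε : ℝ in 𝓝[>] 0, ∀ f a,
      y f a + ε * (y f a - y' f a) ≤ ∑ m, I.unit m * (z f a m : ℝ) := by
    refine eventually_all.mpr fun f => eventually_all.mpr fun a => ?_
    filter_upwards [key (∑ m, I.unit m * (z f a m : ℝ) - y f a)
      (∑ m, I.unit m * (z f a m : ℝ) - y' f a) (sub_nonneg.mpr (h.arc_rate_le f a))
      (by rw [sub_eq_zero, sub_eq_zero, eq_comm, hu f a, eq_comm])] with ε hε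
    linarith
  obtain ⟨ε, ⟨⟨h1, h2⟩, h3⟩, hε⟩ := (((e1.and e2).and e3).and self_mem_nhdsWithin).exists
  refine ⟨ε, hε, fun f a => y f a + ε * (y f a - y' f a),
    ⟨fun f i => ?_, h3, h.alloc_le, h1, h2⟩⟩
  have b := h.balance f i
  have b' := h'.balance f i
  simp only [Finset.sum_add_distrib, ← Finset.mul_sum, Finset.sum_sub_distrib]
  split_ifs at b b' ⊢
  · linear_combination (1 + ε) * b - ε * b'
  · linear_combination (1 + ε) * b - ε * b'
  · linear_combination (1 + ε) * b - ε * b'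

open Classical in
/-- The combinatorial type of some realization of a rate vector. -/
noncomputable def someProfile (r : RateVector I.F) : I.Profile :=
  if h : r ∈ I.rateVectors then profile r h.choose h.choose_spec.choose else profile r 0 0

theorem reducedCost_eq_spObjective_sub {μ : DualValues I.F} {fp : ℕ} {r : RateVector I.F}
    (hr : r ∈ I.rateVectors) (hfp : ∀ f : Fin I.F, (f : ℕ) < fp → r f = 0) :
    reducedCost μ r = I.spObjective μ fp r
      - ∑ f ∈ Finset.univ.filter (fun f : Fin I.F => firstFlow r ≤ f.val), μ.pi f := by
  have hnn := nonneg_of_mem_rateVectors hr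
  rw [reducedCost, spObjective, sum_filter_le_eq_sum_pos hnn _ fun _ => firstFlow_le_of_pos,
    sum_filter_le_eq_sum_pos hnn]
  intro f hf
  by_contra hlt
  exact hf.ne' (hfp f (not_le.mp hlt))

/-- A rate vector of the same combinatorial type as an optimal rate vector of a subproblem has
no larger reduced cost. -/
theorem SPOptimal.reducedCost_le {μ : DualValues I.F} {fp : ℕ} {r r' : RateVector I.F}
    (hr : I.SPOptimal μ fp r) (hr' : r' ∈ I.rateVectors)
    (hp : someProfile r = someProfile r') : reducedCost μ r' ≤ reducedCost μ r := by
  obtain ⟨⟨y₀, z₀, h₀, hfp⟩, hmin⟩ := hr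
  have hr : r ∈ I.rateVectors := ⟨y₀, z₀, h₀⟩
  simp only [someProfile, dif_pos hr, dif_pos hr'] at hp
  -- The chosen realization may differ from the one found in the subproblem; this is harmless, since
  -- the objective and the vanishing conditions involve only the rates.
  have hreal := hr.choose_spec.choose_spec
  have hreal' := hr'.choose_spec.choose_spec
  have hzero : ∀ f, r f = 0 ↔ r' f = 0 := by
    simp only [profile, Prod.mk.injEq, funext_iff, eq_iff_iff] at hp
    exact hp.2.1
  have hfp' : ∀ f : Fin I.F, (f : ℕ) < fp → r' f = 0 := fun f hf => (hzero f).mp (hfp f hf)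
  obtain ⟨ε, hε, y'', h''⟩ := hreal.exists_extrapolation hreal' hp
  have hobj : I.spObjective μ fp r' ≤ I.spObjective μ fp r := by
    -- The objective is affine: had `r'` a larger objective than `r`, the point beyond `r` would
    -- beat `r`.
    have := hmin _ y'' _ ⟨h'', fun f hf => by rw [hfp f hf, hfp' f hf]; ring⟩
    simp only [spObjective, add_mul, mul_assoc, sub_mul, Finset.sum_add_distrib, ← Finset.mul_sum,
      Finset.sum_sub_distrib] at this ⊢
    have h2 : ∑ f ∈ Finset.univ.filter (fun f : Fin I.F => fp ≤ f.val), r f * μ.lam f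
        - ∑ f ∈ Finset.univ.filter (fun f : Fin I.F => fp ≤ f.val), r' f * μ.lam f ≤ 0 :=
      nonpos_of_mul_nonpos_right (a := ε) (by linarith) hε
    linarith
  have hff : firstFlow r' = firstFlow r := firstFlow_congr fun f => by
    rw [(h₀.rate_nonneg f).lt_iff_ne', (nonneg_of_mem_rateVectors hr' f).lt_iff_ne', Ne, Ne,
      hzero f]
  rw [reducedCost_eq_spObjective_sub hr' hfp', reducedCost_eq_spObjective_sub hr hfp, hff]
  exact sub_le_sub_right hobj _

/-- The columns that a subproblem covers have no smaller reduced cost than its optimal rate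
vectors. -/
theorem SPOptimal.reducedCost_le_of_firstFlow {μ : DualValues I.F} (hpi : ∀ f, μ.pi f ≤ 0)
    {fp : ℕ} {r v : RateVector I.F} (hr : I.SPOptimal μ fp r) (hv : v ∈ I.rateVectors)
    (h1 : fp ≤ firstFlow v) (h2 : firstFlow v ≤ firstFlow r) :
    reducedCost μ r ≤ reducedCost μ v := by
  obtain ⟨⟨y₀, z₀, h₀, hfp⟩, hmin⟩ := hr
  have hfpv : ∀ f : Fin I.F, (f : ℕ) < fp → v f = 0 := fun f hf =>
    eq_zero_of_lt_firstFlow (nonneg_of_mem_rateVectors hv) (hf.trans_le h1)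
  rw [reducedCost_eq_spObjective_sub ⟨y₀, z₀, h₀⟩ hfp, reducedCost_eq_spObjective_sub hv hfpv]
  obtain ⟨y, z, h⟩ := hv
  -- The `pi` sum for `v` starts no later than that for `r`, and the additional terms are
  -- nonpositive.
  refine sub_le_sub (hmin v y z ⟨h, hfpv⟩) ?_
  rw [Finset.sum_filter, Finset.sum_filter]
  refine Finset.sum_le_sum fun f _ => ?_
  by_cases hf : firstFlow r ≤ f
  · rw [if_pos hf, if_pos (h2.trans hf)]
  · rw [if_neg hf]
    split_ifs
    · exact hpi f
    · exact le_rfl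

theorem SPOptimal.mem_rateVectors {μ : DualValues I.F} {fp : ℕ} {r : RateVector I.F}
    (hr : I.SPOptimal μ fp r) : r ∈ I.rateVectors := by
  obtain ⟨⟨y, z, h, -⟩, -⟩ := hr
  exact ⟨y, z, h⟩

theorem SPOptimal.le_firstFlow {μ : DualValues I.F} {fp : ℕ} {r : RateVector I.F}
    (hr : I.SPOptimal μ fp r) (hfp : fp ≤ I.F) : fp ≤ firstFlow r := by
  obtain ⟨⟨y, z, -, h⟩, -⟩ := hr
  exact _root_.le_firstFlow hfp fun f hf => by rw [h f hf]; exact lt_irrefl 0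

end IFDP

/-! ### Correctness and progress of the algorithm -/

namespace IFDP

variable {Node : Type*} [Fintype Node] [DecidableEq Node] {I : IFDP Node}

/-- The rate vector `best` of reduced cost `optimum` solves a subproblem, and no rate vector whose
first flow precedes `fp` has a smaller reduced cost; before the first subproblem is solved, there
is no such `best`. -/
def PricingInvariant (μ : DualValues I.F) (fp : ℕ) (optimum : WithTop ℝ)
    (best : Option (RateVector I.F)) : Prop :=
  (fp = 0 ∧ optimum = ⊤ ∧ best = none) ∨
    ∃ r fp', best = some r ∧ optimum = ((reducedCost μ r : ℝ) : WithTop ℝ) ∧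
      I.SPOptimal μ fp' r ∧
      ∀ v ∈ I.rateVectors, firstFlow v < I.F → firstFlow v < fp → reducedCost μ r ≤ reducedCost μ v

/-- The invariant of the column generation algorithm. -/
def Invariant : State I.F → Prop
  | .master V => I.IsInitial V
  | .pricing V x μ fp optimum best => (∀ v ∈ V, v ∈ I.rateVectors) ∧ I.RMPOptimal V x ∧
      I.DualOptimal V μ ∧ PricingInvariant μ fp optimum best
  | .done V x => (∀ v ∈ V, v ∈ I.rateVectors) ∧ I.RMPOptimal V x ∧
      ∃ μ, I.DualOptimal V μ ∧ ∀ v ∈ I.rateVectors, columnValue μ v ≤ 1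

theorem IsInitial.insert {V : Finset (RateVector I.F)} (hV : I.IsInitial V) {r : RateVector I.F}
    (hr : r ∈ I.rateVectors) : I.IsInitial (insert r V) := by
  obtain ⟨hV, x, hx⟩ := hV
  refine ⟨fun v hv => ?_, hx.mono (Finset.subset_insert r V)⟩
  rcases Finset.mem_insert.mp hv with rfl | hv
  · exact hr
  · exact hV v hv

section Pricing

variable {V : Finset (RateVector I.F)} {x : RateVector I.F → ℝ} {μ : DualValues I.F} {fp : ℕ}
  {optimum : WithTop ℝ} {best : Option (RateVector I.F)} {r : RateVector I.F}

/-- Vectors with first flow from `fp` to `firstFlow r` are settled by the current subproblem;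
earlier ones by the previous best value, which `r` beats. -/
theorem PricingInvariant.improve (hμ : I.DualFeasible V μ)
    (h : PricingInvariant μ fp optimum best) (hr : I.SPOptimal μ fp r)
    (hlt : ((reducedCost μ r : ℝ) : WithTop ℝ) < optimum) :
    PricingInvariant μ (firstFlow r + 1) ((reducedCost μ r : ℝ) : WithTop ℝ) (some r) := by
  refine Or.inr ⟨r, fp, rfl, rfl, hr, fun v hv hvF hvr => ?_⟩
  rcases le_or_gt fp (firstFlow v) with hfp | hfp
  · exact hr.reducedCost_le_of_firstFlow hμ.pi_nonpos hv hfp (Nat.lt_succ_iff.mp hvr)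
  · rcases h with ⟨rfl, -, -⟩ | ⟨r', -, -, rfl, -, h⟩
    · exact absurd hfp (Nat.not_lt_zero _)
    · exact (WithTop.coe_lt_coe.mp hlt).le.trans (h v hv hvF hfp)

theorem PricingInvariant.skip (hμ : I.DualFeasible V μ)
    (h : PricingInvariant μ fp optimum best) (hr : I.SPOptimal μ fp r)
    (hlt : ¬ ((reducedCost μ r : ℝ) : WithTop ℝ) < optimum) :
    PricingInvariant μ (firstFlow r + 1) optimum best := by
  rcases h with ⟨-, rfl, -⟩ | ⟨r', fp', rfl, rfl, hr', h⟩
  -- The first subproblem always improves on `⊤`, so a skip presupposes a best vector.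
  · exact absurd (WithTop.coe_lt_top _) hlt
  · refine Or.inr ⟨r', fp', rfl, rfl, hr', fun v hv hvF hvr => ?_⟩
    rcases le_or_gt fp (firstFlow v) with hfp | hfp
    · exact (not_lt.mp fun hh => hlt (WithTop.coe_lt_coe.mpr hh)).trans
        (hr.reducedCost_le_of_firstFlow hμ.pi_nonpos hv hfp (Nat.lt_succ_iff.mp hvr))
    · exact h v hv hvF hfp

theorem PricingInvariant.exists_spOptimal (h : PricingInvariant μ fp optimum (some r)) :
    ∃ fp', I.SPOptimal μ fp' r := by
  rcases h with ⟨-, -, h⟩ | ⟨r', fp', he, -, hr', -⟩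
  · simp at h
  · obtain rfl := Option.some.inj he
    exact ⟨fp', hr'⟩

theorem PricingInvariant.reducedCost_le (h : PricingInvariant μ fp optimum (some r))
    (hfp : I.F ≤ fp) {v : RateVector I.F} (hv : v ∈ I.rateVectors) (hvF : firstFlow v < I.F) :
    reducedCost μ r ≤ reducedCost μ v := by
  rcases h with ⟨-, -, h⟩ | ⟨r', fp', he, -, -, hmin⟩
  · simp at h
  · obtain rfl := Option.some.inj he
    exact hmin v hv hvF (hvF.trans_le hfp)

theorem PricingInvariant.columnValue_le (h : PricingInvariant μ fp optimum (some r))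
    (hfp : I.F ≤ fp) (hr : reducedCost μ r = 0) {v : RateVector I.F} (hv : v ∈ I.rateVectors) :
    columnValue μ v ≤ 1 := by
  by_cases hvF : firstFlow v < I.F
  · have := h.reducedCost_le hfp hv hvF
    rw [hr, reducedCost_eq μ (nonneg_of_mem_rateVectors hv)] at this
    linarith
  · rw [columnValue_eq_zero μ (mt exists_pos_iff_firstFlow_lt.mp hvF)]
    exact zero_le_one

/-- The smallest reduced cost is never positive. -/
theorem PricingInvariant.reducedCost_nonpos (h : PricingInvariant μ fp optimum (some r))
    (hfp : I.F ≤ fp) (hV : ∀ v ∈ V, v ∈ I.rateVectors) (hx : I.RMPOptimal V x)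
    (hμ : I.DualOptimal V μ) : reducedCost μ r ≤ 0 := by
  obtain ⟨v, hv, hcol⟩ := hx.exists_columnValue_eq_one hμ
  have hvF : firstFlow v < I.F := by
    rw [← exists_pos_iff_firstFlow_lt]
    by_contra hne
    rw [columnValue_eq_zero μ hne] at hcol
    exact zero_ne_one hcol
  have := h.reducedCost_le hfp (hV v hv) hvF
  rwa [reducedCost_eq μ (nonneg_of_mem_rateVectors (hV v hv)), hcol, sub_self] at this

/-- A column of negative reduced cost has a new combinatorial type. -/
theorem PricingInvariant.someProfile_notMem (h : PricingInvariant μ fp optimum (some r))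
    (hV : ∀ v ∈ V, v ∈ I.rateVectors) (hμ : I.DualFeasible V μ) (hr : reducedCost μ r < 0) :
    someProfile r ∉ someProfile '' (V : Set (RateVector I.F)) := by
  rintro ⟨v, hv, he⟩
  obtain ⟨fp', hsp⟩ := h.exists_spOptimal
  have h1 := hsp.reducedCost_le (hV v hv) he.symm
  rw [reducedCost_eq μ (nonneg_of_mem_rateVectors (hV v hv))] at h1
  have := hμ.columnValue_le hv
  linarith

end Pricing

theorem Invariant.step {S S' : State I.F} (hS : Invariant S) (h : I.Step S S') :
    Invariant S' := by
  cases h with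
  | solveRMP V x μ hx hμ => exact ⟨hS.1, hx, hμ, Or.inl ⟨rfl, rfl, rfl⟩⟩
  | solveSPImprove V x μ fp optimum best r hfp hr hlt =>
    exact ⟨hS.1, hS.2.1, hS.2.2.1, hS.2.2.2.improve hS.2.2.1.1 hr hlt⟩
  | solveSPSkip V x μ fp optimum best r hfp hr hlt =>
    exact ⟨hS.1, hS.2.1, hS.2.2.1, hS.2.2.2.skip hS.2.2.1.1 hr hlt⟩
  | addColumn V x μ fp optimum v hfp hv =>
    obtain ⟨fp', hsp⟩ := hS.2.2.2.exists_spOptimal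
    exact IsInitial.insert ⟨hS.1, x, hS.2.1.1⟩ hsp.mem_rateVectors
  | noColumn V x μ fp optimum v hfp hv => exact ⟨hS.1, x, hS.2.1.1⟩
  | halt V x μ fp optimum v hfp hv =>
    exact ⟨hS.1, hS.2.1, μ, hS.2.2.1, fun w hw => hS.2.2.2.columnValue_le hfp hv hw⟩

theorem Invariant.reflTransGen {S S' : State I.F} (hS : Invariant S)
    (h : Relation.ReflTransGen I.Step S S') : Invariant S' := by
  induction h with
  | refl => exact hS
  | tail _ hstep ih => exact ih.step hstep

theorem Invariant.exists_step {S : State I.F} (hS : Invariant S) (hdone : ∀ V x, S ≠ .done V x) :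
    ∃ S', I.Step S S' := by
  cases S with
  | master V =>
    obtain ⟨x, hx⟩ := exists_rmpOptimal hS.2
    obtain ⟨μ, hμ⟩ := hx.exists_dualOptimal
    exact ⟨_, .solveRMP V x μ hx hμ⟩
  | pricing V x μ fp optimum best =>
    rcases lt_or_ge fp I.F with hfp | hfp
    · obtain ⟨r, hr⟩ := exists_spOptimal μ fp
      by_cases hlt : ((reducedCost μ r : ℝ) : WithTop ℝ) < optimum
      · exact ⟨_, .solveSPImprove V x μ fp optimum best r hfp hr hlt⟩
      · exact ⟨_, .solveSPSkip V x μ fp optimum best r hfp hr hlt⟩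
    · rcases hS.2.2.2 with ⟨rfl, -, -⟩ | ⟨r, -, rfl, -⟩
      -- As there is at least one flow, the loop cannot end before a subproblem has been solved.
      · exact absurd I.F_pos (not_lt.mpr hfp)
      · rcases lt_trichotomy (reducedCost μ r) 0 with h | h | h
        · exact ⟨_, .addColumn V x μ fp optimum r hfp h⟩
        · exact ⟨_, .halt V x μ fp optimum r hfp h⟩
        · exact ⟨_, .noColumn V x μ fp optimum r hfp h⟩
  | done V x => exact absurd rfl (hdone V x)

/-! ### Bound on the number of steps -/

/-- The number of combinatorial types that do not occur in `V`. -/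
noncomputable def missingProfiles (V : Finset (RateVector I.F)) : ℕ :=
  Nat.card I.Profile - (someProfile '' (V : Set (RateVector I.F))).ncard

theorem missingProfiles_insert_lt {V : Finset (RateVector I.F)} {r : RateVector I.F}
    (hr : someProfile r ∉ someProfile '' (V : Set (RateVector I.F))) :
    missingProfiles (insert r V) < missingProfiles V := by
  have h1 : (someProfile '' ((insert r V : Finset (RateVector I.F)) : Set (RateVector I.F))).ncard
      = (someProfile '' (V : Set (RateVector I.F))).ncard + 1 := by
    rw [Finset.coe_insert, Set.image_insert_eq, Set.ncard_insert_of_notMem hr (Set.toFinite _)]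
  -- Ensures that the truncated subtraction in `missingProfiles` really drops.
  have h2 := Set.ncard_le_card
    (someProfile '' ((insert r V : Finset (RateVector I.F)) : Set (RateVector I.F)))
  unfold missingProfiles
  omega

/-- An upper bound on the number of steps that remain to be made. -/
noncomputable def potential : State I.F → ℕ
  | .master V => missingProfiles V * (I.F + 4) + (I.F + 3)
  | .pricing V _ _ fp _ _ => missingProfiles V * (I.F + 4) + (I.F + 1 - fp) + 1
  | .done _ _ => 0

/-- A round enters pricing at offset `F + 2`, just below the `F + 3` of the master state, and every
subproblem raises `fp`. The final `+ 1` leaves room for halting; a new column frees `F + 4`, which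
pays for the next round. -/
theorem Invariant.potential_lt {S S' : State I.F} (hS : Invariant S) (h : I.Step S S') :
    potential S' < potential S := by
  cases h with
  | solveRMP V x μ hx hμ => simp only [potential]; omega
  | solveSPImprove V x μ fp optimum best r hfp hr hlt =>
    have := hr.le_firstFlow hfp.le
    simp only [potential]
    omega
  | solveSPSkip V x μ fp optimum best r hfp hr hlt =>
    have := hr.le_firstFlow hfp.le
    simp only [potential]
    omega
  | addColumn V x μ fp optimum v hfp hv =>
    have h1 := missingProfiles_insert_lt (hS.2.2.2.someProfile_notMem hS.1 hS.2.2.1.1 hv)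
    have h2 := Nat.mul_le_mul_right (I.F + 4) (Nat.succ_le_of_lt h1)
    rw [Nat.succ_mul] at h2
    simp only [potential]
    omega
  | noColumn V x μ fp optimum v hfp hv =>
    exact absurd hv (not_lt.mpr (hS.2.2.2.reducedCost_nonpos hfp hS.1 hS.2.1 hS.2.2.1))
  | halt V x μ fp optimum v hfp hv => simp [potential]

theorem Invariant.add_potential_le {run : ℕ → State I.F} (h0 : Invariant (run 0)) :
    ∀ n : ℕ, (∀ i < n, I.Step (run i) (run (i + 1))) →
      Invariant (run n) ∧ n + potential (run n) ≤ potential (run 0)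
  | 0, _ => ⟨h0, by simp⟩
  | n + 1, h => by
    obtain ⟨h1, h2⟩ := add_potential_le h0 n fun i hi => h i (hi.trans n.lt_succ_self)
    have hstep := h n n.lt_succ_self
    have := h1.potential_lt hstep
    exact ⟨h1.step hstep, by omega⟩

end IFDP

theorem theorem4 {Node : Type*} [Fintype Node] [DecidableEq Node] (I : IFDP Node) :
    -- a start is possible exactly if the problem is feasible
    ((∃ V₀, I.IsInitial V₀) ↔ ∃ σ, I.IsFeasible σ) ∧
    ∃ N : ℕ, ∀ V₀, I.IsInitial V₀ →
      -- every run makes at most `N` steps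
      (∀ (n : ℕ) (run : ℕ → IFDP.State I.F), run 0 = .master V₀ →
        (∀ i < n, I.Step (run i) (run (i + 1))) → n ≤ N) ∧
      -- a run never gets stuck before it stops
      (∀ S, Relation.ReflTransGen I.Step (.master V₀) S →
        (∀ V x, S ≠ .done V x) → ∃ S', I.Step S S') ∧
      -- when it stops, the constructed schedule is a global optimum
      (∀ V x, Relation.ReflTransGen I.Step (.master V₀) (.done V x) →
        (∃ σ, I.IsConstructedSchedule V x σ) ∧
        ∀ σ, I.IsConstructedSchedule V x σ → I.IsOptimal σ) := by
  refine ⟨IFDP.exists_isInitial_iff, Nat.card I.Profile * (I.F + 4) + (I.F + 3),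
    fun V₀ hV₀ => ⟨fun n run h0 hrun => ?_, fun S hS hdone => ?_, fun V x hS => ?_⟩⟩
  · have hinv : IFDP.Invariant (run 0) := by rw [h0]; exact hV₀
    have h1 := (hinv.add_potential_le n hrun).2
    have h2 : IFDP.potential (run 0) ≤ Nat.card I.Profile * (I.F + 4) + (I.F + 3) := by
      rw [h0]
      exact Nat.add_le_add_right (Nat.mul_le_mul_right _ (Nat.sub_le _ _)) _
    omega
  · exact (IFDP.Invariant.reflTransGen (S := .master V₀) hV₀ hS).exists_step hdone
  · obtain ⟨hV, hx, μ, hμ, hcol⟩ := IFDP.Invariant.reflTransGen (S := .master V₀) hV₀ hS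
    exact ⟨IFDP.exists_isConstructedSchedule V x, fun σ hσ => hσ.isOptimal hx hV hμ hcol⟩
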